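/- Let $k\ge 2$ be an integer. A \emph{$k$-Stirling permutation} of order $n$ is a permutation of the multiset $\{1^k,2^k,\dots,n^k\}$ in which, for every $i$, all elements between two occurrences of $i$ are at least $i$. A \emph{block} of a $k$-Stirling permutation $a_1\cdots a_{kn}$ is a substring $a_p\cdots a_q$ with $a_p=a_q$ that is not contained in any larger such substring; its label is $a_p=a_q$ and its size is $q-p+1$. Let the random $k$-Stirling permutation grow in the natural way: it starts with $1^k=1\cdots1$ at order $1$, and the permutation of order $n+1$ is obtained from that of order $n$ by inserting the string $(n+1)^k$ in one of the $kn+1$ gaps (including first and last), chosen uniformly at random and independently of the past. Let $\widetilde K_{n,i}$ be the size of the $i$th block of the permutation of order $n$ when its blocks are ordered by increasing label, with $\widetilde K_{n,i}=0$ if there are fewer than $i$ blocks. Then there exists a sequence $(\beta_m)_{m\ge1}$ of independent random variables, defined on the same probability space, with the beta distributions $$\beta_m\sim\mathrm{Beta}\Bigl(\frac{k-1}{k},\frac{m+1}{k}\Bigr),\qquad m\ge1,$$ such that, almost surely, as $n\to\infty$, $$\frac1{kn}\bigl(\widetilde K_{n,1},\widetilde K_{n,2},\widetilde K_{n,3},\dots\bigr)\longrightarrow\bigl(\beta_1,\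 (1-\beta_1)\beta_2,\ (1-\beta_1)(1-\beta_2)\beta_3,\ \dots\bigr),$$ where the convergence holds both componentwise (in the product topology) and in the $\ell^1$-metric $d\bigl((p_i),(p_i')\bigr)=\sum_i|p_i-p_i'|$. -/

import Mathlib

open MeasureTheory ProbabilityTheory Filter Topology

/-- `Q_n(k)`: the `k`-Stirling permutations of order `n`. These are the arrangements, written as
lists, of the multiset `{1^k, 2^k, …, n^k}` in which every element lying between two occurrences of
a label `i` is at least `i`. -/
def stirlingPerms (k n : ℕ) : Set (List ℕ) :=
  {l | (∀ j, l.count j = if 1 ≤ j ∧ j ≤ n then k else 0) ∧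
    ∀ i j, [i, j, i].Sublist l → i ≤ j}

/-- Insert the string `a^k = a ⋯ a` into the word `l` at gap number `p`, that is, after the first
`p` letters of `l`. A word of length `ℓ` has the `ℓ + 1` gaps `0, …, ℓ` (first and last included). -/
def insertRun (k a p : ℕ) (l : List ℕ) : List ℕ :=
  l.take p ++ List.replicate k a ++ l.drop p

/-- The growth of a `k`-Stirling permutation along a sequence of gaps: start with the empty word
(order `0`); the word of order `n + 1` arises from the word of order `n`, which has length `k * n`,
by inserting the string `(n+1)^k` at the gap `g n ∈ {0, …, k * n}`. -/
def stirlingGrowth (k : ℕ) (g : (n : ℕ) → Fin (k * n + 1)) : ℕ → List ℕ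
  | 0 => []
  | n + 1 => insertRun k (n + 1) (g n) (stirlingGrowth k g n)

/-- The positions `p ≤ q` (counted from `0`) delimit a block of `l`: the substring from position
`p` to position `q` has equal first and last letters, and it is not contained in any larger such
substring. -/
def IsBlock (l : List ℕ) (p q : ℕ) : Prop :=
  p ≤ q ∧ q < l.length ∧ l[p]? = l[q]? ∧
    ∀ p' ≤ p, ∀ q' < l.length, q ≤ q' → l[p']? = l[q']? → p' = p ∧ q' = q

instance (l : List ℕ) (p q : ℕ) : Decidable (IsBlock l p q) := by
  unfold IsBlock; infer_instance

/-- The blocks of `l`, as pairs (first position, last position). -/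
def blocks (l : List ℕ) : Finset (ℕ × ℕ) :=
  (Finset.range l.length ×ˢ Finset.range l.length).filter fun b => IsBlock l b.1 b.2

/-- The label of a block: its first (and last) letter. -/
def blockLabel (l : List ℕ) (b : ℕ × ℕ) : ℕ := l.getD b.1 0

/-- The size `K̃_{m+1}` of block number `m + 1` of `l` when the blocks are listed by increasing
label, i.e. of the block for which exactly `m` blocks have a smaller label; it is `0` if `l` has
at most `m` blocks. (Distinct blocks have distinct labels, see `blockLabel_injOn`, so the sum has
at most one term.) -/
def blockSize (l : List ℕ) (m : ℕ) : ℕ :=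
  ∑ b ∈ (blocks l).filter fun b =>
      ((blocks l).filter fun b' => blockLabel l b' < blockLabel l b).card = m,
    (b.2 - b.1 + 1)

/-- Distinct blocks have distinct labels. -/
theorem blockLabel_injOn (l : List ℕ) : Set.InjOn (blockLabel l) (blocks l : Set (ℕ × ℕ)) := by
  rintro ⟨p, q⟩ hb ⟨p', q'⟩ hb' h
  simp only [blocks, Finset.coe_filter, Finset.mem_product, Finset.mem_range, Set.mem_ofPred_eq]
    at hb hb'
  obtain ⟨⟨hp, hq⟩, hpq, -, he, hmax⟩ := hb
  obtain ⟨⟨hp', hq'⟩, hpq', -, he', hmax'⟩ := hb'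
  have hpp : l[p]? = l[p']? := by
    simp only [blockLabel, List.getD_eq_getElem?_getD, List.getElem?_eq_getElem hp,
      List.getElem?_eq_getElem hp', Option.getD_some] at h ⊢
    rw [h]
  rcases le_total p p' with h1 | h1 <;> rcases le_total q q' with h2 | h2
  · obtain ⟨-, rfl⟩ := hmax p le_rfl q' hq' h2 (by rw [hpp, he'])
    obtain ⟨rfl, -⟩ := hmax' p h1 q' hq' le_rfl (by rw [hpp, he'])
    rfl
  · obtain ⟨rfl, rfl⟩ := hmax' p h1 q hq h2 he
    rfl
  · obtain ⟨rfl, rfl⟩ := hmax p' h1 q' hq' h2 he'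
    rfl
  · obtain ⟨-, rfl⟩ := hmax' p' le_rfl q hq h2 (by rw [← hpp, he])
    obtain ⟨rfl, -⟩ := hmax p' h1 q hq le_rfl (by rw [← hpp, he])
    rfl

/-- Inserting `(n+1)^k` at any gap of a `k`-Stirling permutation of order `n` gives a `k`-Stirling
permutation of order `n + 1`. -/
theorem insertRun_mem_stirlingPerms {k n : ℕ} {l : List ℕ} (hl : l ∈ stirlingPerms k n) (p : ℕ) :
    insertRun k (n + 1) p l ∈ stirlingPerms k (n + 1) := by
  obtain ⟨hc, hs⟩ := hl
  have hcount : ∀ j, (insertRun k (n + 1) p l).count j =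
      if 1 ≤ j ∧ j ≤ n + 1 then k else 0 := by
    intro j
    have h1 : (l.take p).count j + (l.drop p).count j = l.count j := by
      rw [← List.count_append, List.take_append_drop]
    rw [hc j] at h1
    simp only [insertRun, List.count_append, List.count_replicate, beq_iff_eq]
    grind
  refine ⟨hcount, fun i j hij => ?_⟩
  have hnl : n + 1 ∉ l := by
    rw [← List.count_eq_zero, hc]; simp
  have hT : n + 1 ∉ l.take p := fun h => hnl (List.mem_of_mem_take h)
  have hD : n + 1 ∉ l.drop p := fun h => hnl (List.mem_of_mem_drop h)
  by_cases hj : j = n + 1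
  · have hi : i ∈ insertRun k (n + 1) p l := hij.subset (by simp)
    have := hcount i
    have h0 := List.count_pos_iff.2 hi
    grind
  by_cases hi : i = n + 1
  · subst hi
    exfalso
    simp only [insertRun, List.append_assoc] at hij
    have h2 := hij.count_le (n + 1)
    obtain ⟨a, b, hab, ha, hb⟩ := List.sublist_append_iff.1 hij
    have ha' : n + 1 ∉ a := fun h => hT (ha.subset h)
    have hae : a = [] := by
      cases a with
      | nil => rfl
      | cons x t => simp at hab; simp [← hab.1] at ha'
    subst hae
    rw [List.nil_append] at hab
    subst hab
    obtain ⟨c, d, hcd, hc', hd'⟩ := List.sublist_append_iff.1 hb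
    have hd'' : n + 1 ∉ d := fun h => hD (hd'.subset h)
    have hdn : d = [] := by
      rcases List.eq_nil_or_concat d with h | ⟨t, x, h⟩
      · exact h
      · exfalso
        have := congrArg List.getLast? hcd
        subst h
        simp at this
        simp [← this] at hd''
    subst hdn
    rw [List.append_nil] at hcd
    subst hcd
    have : j ∈ List.replicate k (n + 1) := hc'.subset (by simp)
    exact hj (List.eq_of_mem_replicate this)
  · apply hs
    have h3 := hij.filter (fun x => decide (x ≠ n + 1))
    have hfT : (l.take p).filter (fun x => decide (x ≠ n + 1)) = l.take p :=
      List.filter_eq_self.2 fun x hx => by simpa using fun h : x = n + 1 => hT (h ▸ hx)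
    have hfD : (l.drop p).filter (fun x => decide (x ≠ n + 1)) = l.drop p :=
      List.filter_eq_self.2 fun x hx => by simpa using fun h : x = n + 1 => hD (h ▸ hx)
    have hfR : (List.replicate k (n + 1)).filter (fun x => decide (x ≠ n + 1)) = [] := by simp
    rw [insertRun, List.filter_append, List.filter_append, hfT, hfD, hfR, List.append_nil,
      List.take_append_drop] at h3
    simpa [List.filter_cons, hi, hj] using h3

/-- The growth process takes its values in the `k`-Stirling permutations. -/
theorem stirlingGrowth_mem (k : ℕ) (g : (n : ℕ) → Fin (k * n + 1)) (n : ℕ) :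
    stirlingGrowth k g n ∈ stirlingPerms k n := by
  induction n with
  | zero =>
    refine ⟨fun j => ?_, fun i j h => ?_⟩
    · simp only [stirlingGrowth, List.count_nil]; grind
    · simp [stirlingGrowth] at h
  | succ n ih => exact insertRun_mem_stirlingPerms ih _

/-!
Inserting `(n+1)^k` at a gap inside a block makes that block grow by `k`; at a gap outside all
blocks it creates a new block, which has the largest label (`blockSize_insertRun`). A block of size
`s` has `s - 1` inner gaps (`card_growthIndex_eq`) and the block sizes add up to `k * n`
(`sum_blockSize`), so the sizes in order of label, divided by `k`, form a Chinese
restaurant process with both parameters `1/k`.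

Restricted to the insertions that do not touch the blocks before number `m`, the choice between
block `m` and all later blocks is a Pólya urn with weights `c_m - 1` and `s_{m+1} + m + 2`, where
`c_m` is the size of block `m` and `s_m` is the number of letters outside the blocks before it. One
draw of such an urn preserves the mean of ratios of rising factorials (`risingRatio_step`).
Different urns do not interfere, so products of such ratios over several urns are bounded
martingales (`sum_prod_urnFactor`, `martingale_urnProd`). With a single factor of exponent one,
martingale convergence gives the almost sure limit `β_m` of `c_m / s_m`. With general exponents, the
constant mean identifies all mixed moments of the limits as the products of the moments of beta
distributions (`integral_prod_urnLimit`). Sequences in the unit interval have laws determined by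
their mixed moments (`Measure.ext_of_mixed_moments`), so the `β_m` are independent and beta
distributed (`map_urnLimit`).

The limits need `s_m → ∞`. The first gap lies outside all blocks and, by the second Borel–Cantelli
lemma, is chosen infinitely often, so the number of blocks tends to infinity
(`ae_frequently_gap_eq_zero`, `tendsto_card_blocks`). The sizes divided by `k * n` then converge
componentwise by multiplying the limits of `c_m / s_m`. The limit has total mass one because
`∏ (1 - β_i)` has mean tending to zero (`ae_tendsto_prod_one_sub_urnLimit`), and Scheffé's lemma upgrades
the convergence to `ℓ¹` (`tendsto_tsum_enorm_sub_of_hasSum`).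
-/

/-! ### Blocks of a word and insertion of a run of a new letter -/

theorem mem_blocks {l : List ℕ} {b : ℕ × ℕ} : b ∈ blocks l ↔ IsBlock l b.1 b.2 := by
  simp only [blocks, Finset.mem_filter, Finset.mem_product, Finset.mem_range, and_iff_right_iff_imp]
  exact fun h => ⟨h.1.trans_lt h.2.1, h.2.1⟩

/-- Every substring with equal first and last letters is contained in a block. -/
theorem exists_block_of_getElem?_eq {l : List ℕ} {x y : ℕ} (hxy : x ≤ y) (hy : y < l.length)
    (h : l[x]? = l[y]?) : ∃ b ∈ blocks l, b.1 ≤ x ∧ y ≤ b.2 := by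
  let S := (Finset.range l.length ×ˢ Finset.range l.length).filter fun c : ℕ × ℕ =>
    c.1 ≤ x ∧ y ≤ c.2 ∧ l[c.1]? = l[c.2]?
  have hS : S.Nonempty := ⟨(x, y), by simpa [S, hy, hxy.trans_lt hy] using h⟩
  obtain ⟨⟨p, q⟩, hb, hmax⟩ := S.exists_max_image (fun c => c.2 - c.1) hS
  simp only [S, Finset.mem_filter, Finset.mem_product, Finset.mem_range] at hb
  refine ⟨(p, q), mem_blocks.2 ⟨by grind, hb.1.2, hb.2.2.2, fun p' hp' q' hq' hqq he => ?_⟩,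
    hb.2.1, hb.2.2.1⟩
  have := hmax (p', q') (by
    simp only [S, Finset.mem_filter, Finset.mem_product, Finset.mem_range]
    grind)
  simp only at this hp' hqq
  grind

/-- The position, after a string of length `k` has been inserted at gap `p`, of the letter that
was at position `x`. -/
def gapShift (k p x : ℕ) : ℕ := if x < p then x else x + k

theorem gapShift_strictMono (k p : ℕ) : StrictMono (gapShift k p) := by
  intro x y h; unfold gapShift; grind

theorem length_insertRun {k a p : ℕ} {l : List ℕ} :
    (insertRun k a p l).length = l.length + k := by
  simp [insertRun]; grind

theorem getElem?_insertRun_gapShift {k a p : ℕ} {l : List ℕ} (hp : p ≤ l.length) (x : ℕ) :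
    (insertRun k a p l)[gapShift k p x]? = l[x]? := by
  simp only [insertRun, gapShift]
  split_ifs with h
  · rw [List.append_assoc, List.getElem?_append_left (by simp; omega), List.getElem?_take]
    simp [h]
  · rw [List.getElem?_append_right (by simp; grind)]
    simp only [List.length_append, List.length_take, List.length_replicate, List.getElem?_drop]
    congr 1
    rw [min_eq_left hp]
    omega

theorem getElem?_insertRun_run {k a p : ℕ} {l : List ℕ} (hp : p ≤ l.length) {x : ℕ}
    (h1 : p ≤ x) (h2 : x < p + k) : (insertRun k a p l)[x]? = some a := by
  simp only [insertRun]
  rw [List.getElem?_append_left (by simp; omega), List.getElem?_append_right (by simp; omega)]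
  rw [List.getElem?_replicate, if_pos]
  simp; omega

theorem eq_gapShift_or_mem_run (k p x : ℕ) :
    (∃ y, x = gapShift k p y) ∨ (p ≤ x ∧ x < p + k) := by
  by_cases h : x < p
  · exact .inl ⟨x, by simp [gapShift, h]⟩
  · by_cases h' : x < p + k
    · exact .inr ⟨by omega, h'⟩
    · exact .inl ⟨x - k, by unfold gapShift; grind⟩

theorem gapShift_lt_iff {k a p x : ℕ} {l : List ℕ} (hp : p ≤ l.length) :
    gapShift k p x < (insertRun k a p l).length ↔ x < l.length := by
  rw [length_insertRun]; unfold gapShift; grind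

/-- The blocks after inserting a run of a new letter: the old blocks, moved apart, and the new run
unless the gap lies inside a block. -/
theorem mem_blocks_insertRun {k a p : ℕ} {l : List ℕ} (hk : 0 < k) (hp : p ≤ l.length)
    (ha : a ∉ l) {c : ℕ × ℕ} :
    c ∈ blocks (insertRun k a p l) ↔
      (∃ b ∈ blocks l, c = (gapShift k p b.1, gapShift k p b.2)) ∨
      ((¬ ∃ b ∈ blocks l, b.1 < p ∧ p ≤ b.2) ∧ c = (p, p + k - 1)) := by
  have hmono := gapShift_strictMono k p
  have hS := fun x => getElem?_insertRun_gapShift (k := k) (a := a) hp x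
  have hR := fun x => getElem?_insertRun_run (k := k) (a := a) hp (x := x)
  have hna : ∀ x : ℕ, l[x]? ≠ some a := fun x h => ha (List.mem_of_getElem? h)
  have hlen := fun x => gapShift_lt_iff (k := k) (a := a) (x := x) hp
  have hlen' : (insertRun k a p l).length = l.length + k := length_insertRun
  obtain ⟨x, y⟩ := c
  rw [mem_blocks]
  -- Equal letters of the new word are both old or both in the run, as the letter `a` is new.
  constructor
  · rintro ⟨hxy, hy, he, hm⟩
    simp only at hxy hy he hm
    rcases eq_gapShift_or_mem_run k p x with ⟨x, rfl⟩ | hx <;>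
    rcases eq_gapShift_or_mem_run k p y with ⟨y, rfl⟩ | hy'
    · left
      refine ⟨(x, y), mem_blocks.2 ⟨hmono.le_iff_le.1 hxy, (hlen y).1 hy, by
        rwa [hS, hS] at he, fun p' hp' q' hq' hqq h => ?_⟩, rfl⟩
      have := hm _ (hmono.monotone hp') _ ((hlen q').2 hq') (hmono.monotone hqq) (by rw [hS, hS, h])
      exact ⟨hmono.injective this.1, hmono.injective this.2⟩
    · rw [hS, hR y hy'.1 hy'.2] at he
      exact absurd he (hna _)
    · rw [hS, hR x hx.1 hx.2] at he
      exact absurd he.symm (hna _)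
    · right
      constructor
      · rintro ⟨b, hb, h1, h2⟩
        have hb' := mem_blocks.1 hb
        have := hm (gapShift k p b.1) (by unfold gapShift; grind) (gapShift k p b.2)
          ((hlen _).2 hb'.2.1) (by unfold gapShift; grind) (by rw [hS, hS, hb'.2.2.1])
        unfold gapShift at this
        grind
      · have := hm p hx.1 (p + k - 1) (by omega) (by omega)
          (by rw [hR p (by omega) (by omega), hR (p + k - 1) (by omega) (by omega)])
        grind
  · rintro (⟨b, hb, h⟩ | ⟨hno, h⟩)
    · obtain ⟨h1, h2, h3, h4⟩ := mem_blocks.1 hb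
      obtain ⟨rfl, rfl⟩ := Prod.mk.inj h
      refine ⟨hmono.monotone h1, (hlen _).2 h2, by rw [hS, hS, h3], fun p' hp' q' hq' hqq he => ?_⟩
      simp only at hp' hqq
      rcases eq_gapShift_or_mem_run k p p' with ⟨x', rfl⟩ | hx <;>
      rcases eq_gapShift_or_mem_run k p q' with ⟨y', rfl⟩ | hy'
      · have := h4 x' (hmono.le_iff_le.1 hp') y' ((hlen _).1 hq') (hmono.le_iff_le.1 hqq)
          (by rwa [hS, hS] at he)
        exact ⟨by rw [this.1], by rw [this.2]⟩
      · rw [hS, hR q' hy'.1 hy'.2] at he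
        exact absurd he (hna _)
      · rw [hS, hR p' hx.1 hx.2] at he
        exact absurd he.symm (hna _)
      · exfalso
        unfold gapShift at hp' hqq
        grind
    · obtain ⟨rfl, rfl⟩ := Prod.mk.inj h
      refine ⟨by simp only; omega, by simp only; omega, by
        simp only
        rw [hR x (by omega) (by omega), hR (x + k - 1) (by omega) (by omega)],
        fun p' hp' q' hq' hqq he => ?_⟩
      simp only at hp' hqq
      rcases eq_gapShift_or_mem_run k x p' with ⟨x', rfl⟩ | hx <;>
      rcases eq_gapShift_or_mem_run k x q' with ⟨y', rfl⟩ | hy'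
      · by_cases hlt : x' < x
        · by_cases hle : x ≤ y'
          · exfalso
            obtain ⟨b, hb, hb1, hb2⟩ := exists_block_of_getElem?_eq (hlt.le.trans hle)
              ((hlen _).1 hq') (by rwa [hS, hS] at he)
            exact hno ⟨b, hb, by omega, by omega⟩
          · unfold gapShift at hqq; grind
        · unfold gapShift at hp'; grind
      · rw [hS, hR q' hy'.1 hy'.2] at he
        exact absurd he (hna _)
      · rw [hS, hR p' hx.1 hx.2] at he
        exact absurd he.symm (hna _)
      · omega

/-- Two blocks of a Stirling permutation that share a position are equal. -/
theorem blocks_eq_of_overlap {k n : ℕ} {l : List ℕ} (hl : l ∈ stirlingPerms k n)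
    {b c : ℕ × ℕ} (hb : b ∈ blocks l) (hc : c ∈ blocks l) {x : ℕ} (hb1 : b.1 ≤ x) (hb2 : x ≤ b.2)
    (hc1 : c.1 ≤ x) (hc2 : x ≤ c.2) : b = c := by
  wlog hle : b.1 ≤ c.1 generalizing b c
  · exact (this hc hb hc1 hc2 hb1 hb2 (by omega)).symm
  have hsub : ∀ x y z : ℕ, x < y → y < z → ∀ i j, l[x]? = some i → l[y]? = some j →
      l[z]? = some i → i ≤ j := by
    intro x y z hxy hyz i j hx hy hz
    apply hl.2
    rw [List.sublist_iff_exists_orderEmbedding_getElem?_eq]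
    have hzl : z < l.length := by grind
    let f : ℕ → ℕ := fun m =>
      if m = 0 then x else if m = 1 then y else if m = 2 then z else l.length + m
    have hf : StrictMono f := by intro m m' h; simp only [f]; grind
    refine ⟨OrderEmbedding.ofStrictMono f hf, fun m => ?_⟩
    rw [OrderEmbedding.coe_ofStrictMono]
    rcases m with _ | _ | _ | m
    · simp [f, hx]
    · simp [f, hy]
    · simp [f, hz]
    · simp [f]
  obtain ⟨h1, h2, h3, h4⟩ := mem_blocks.1 hb
  obtain ⟨h1', h2', h3', h4'⟩ := mem_blocks.1 hc
  obtain ⟨i, hi⟩ : ∃ i, l[b.1]? = some i := ⟨_, List.getElem?_eq_getElem (h1.trans_lt h2)⟩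
  obtain ⟨j, hj⟩ : ∃ j, l[c.1]? = some j := ⟨_, List.getElem?_eq_getElem (h1'.trans_lt h2')⟩
  rw [hi] at h3
  rw [hj] at h3'
  rcases le_or_gt c.2 b.2 with hle2 | hlt2
  · have := h4' b.1 hle b.2 h2 hle2 (by rw [hi, h3])
    exact Prod.ext this.1 this.2
  -- the blocks interlace, so their labels bound each other and hence agree
  have hij : i = j := by
    rcases hle.eq_or_lt with he | hlt
    · rw [he, hj] at hi; exact (Option.some.inj hi).symm
    rcases (hc1.trans hb2).eq_or_lt with he | hlt'
    · rw [he, ← h3] at hj; exact Option.some.inj hj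
    · exact le_antisymm (hsub _ _ _ hlt hlt' i j hi hj h3.symm)
        (hsub _ _ _ hlt' hlt2 j i hj h3.symm h3'.symm)
  have := h4 b.1 le_rfl c.2 h2' hlt2.le (by rw [hi, ← h3', hij])
  omega

/-! ### Block sizes under insertion -/

/-- The number of blocks with a smaller label: the (zero-based) position of the block `b` when the
blocks are listed by increasing label. -/
def blockRank (l : List ℕ) (b : ℕ × ℕ) : ℕ :=
  ((blocks l).filter fun b' => blockLabel l b' < blockLabel l b).card

theorem blockRank_lt {l : List ℕ} {b : ℕ × ℕ} (hb : b ∈ blocks l) :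
    blockRank l b < (blocks l).card := by
  apply Finset.card_lt_card
  rw [Finset.filter_ssubset]
  exact ⟨b, hb, lt_irrefl _⟩

theorem blockRank_injOn (l : List ℕ) : Set.InjOn (blockRank l) (blocks l : Set (ℕ × ℕ)) := by
  have key : ∀ b ∈ blocks l, ∀ c ∈ blocks l, blockLabel l b < blockLabel l c →
      blockRank l b < blockRank l c := by
    intro b hb c hc h
    apply Finset.card_lt_card
    refine Finset.ssubset_iff_of_subset
      (Finset.monotone_filter_right _ fun b' _ h' => h'.trans h) |>.2 ⟨b, ?_, ?_⟩ <;> simp [hb, h]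
  intro b hb c hc h
  by_contra hne
  rcases lt_trichotomy (blockLabel l b) (blockLabel l c) with h1 | h1 | h1
  · exact (key b hb c hc h1).ne h
  · exact hne (blockLabel_injOn l hb hc h1)
  · exact (key c hc b hb h1).ne' h

theorem exists_blockRank_eq {l : List ℕ} {m : ℕ} (hm : m < (blocks l).card) :
    ∃ b ∈ blocks l, blockRank l b = m := by
  have := Finset.surjOn_of_injOn_of_card_le (s := blocks l) (t := Finset.range (blocks l).card)
    (blockRank l) (fun b hb => by simpa using blockRank_lt hb) (blockRank_injOn l) (by simp)
  simpa using this (by simpa using hm : m ∈ (Finset.range (blocks l).card : Set ℕ))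

theorem blockSize_eq_sum (l : List ℕ) (m : ℕ) :
    blockSize l m = ∑ b ∈ blocks l, if blockRank l b = m then b.2 - b.1 + 1 else 0 := by
  rw [blockSize, Finset.sum_filter]; rfl

theorem blockSize_blockRank {l : List ℕ} {b : ℕ × ℕ} (hb : b ∈ blocks l) :
    blockSize l (blockRank l b) = b.2 - b.1 + 1 := by
  rw [blockSize_eq_sum, Finset.sum_eq_single_of_mem b hb, if_pos rfl]
  intro c hc hcb
  exact if_neg fun h => hcb (blockRank_injOn l hc hb h)

theorem blockSize_eq_zero {l : List ℕ} {m : ℕ} (hm : (blocks l).card ≤ m) : blockSize l m = 0 := by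
  rw [blockSize_eq_sum]
  exact Finset.sum_eq_zero fun b hb => if_neg ((blockRank_lt hb).trans_le hm).ne

theorem blockSize_pos {l : List ℕ} {m : ℕ} (hm : m < (blocks l).card) : 0 < blockSize l m := by
  obtain ⟨b, hb, rfl⟩ := exists_blockRank_eq hm
  rw [blockSize_blockRank hb]; omega

theorem blockLabel_mem {l : List ℕ} {b : ℕ × ℕ} (hb : b ∈ blocks l) : blockLabel l b ∈ l := by
  have h := mem_blocks.1 hb
  have : b.1 < l.length := h.1.trans_lt h.2.1
  simp [blockLabel, this]

open Classical in
/-- The index of the block that grows when a run of a new letter is inserted at gap `p`: the rank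
of the block around the gap or, if there is none, the number of blocks, which is the index of the
new block. -/
noncomputable def growthIndex (l : List ℕ) (p : ℕ) : ℕ :=
  if h : ∃ b ∈ blocks l, b.1 < p ∧ p ≤ b.2 then blockRank l h.choose else (blocks l).card

section Insert

variable {k n p : ℕ} {l : List ℕ}

theorem growthIndex_of_mem (hl : l ∈ stirlingPerms k n) {b : ℕ × ℕ} (hb : b ∈ blocks l)
    (h1 : b.1 < p) (h2 : p ≤ b.2) : growthIndex l p = blockRank l b := by
  have h : ∃ b ∈ blocks l, b.1 < p ∧ p ≤ b.2 := ⟨b, hb, h1, h2⟩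
  rw [growthIndex, dif_pos h]
  obtain ⟨hc, hc1, hc2⟩ := h.choose_spec
  rw [blocks_eq_of_overlap hl hc hb hc1.le hc2 h1.le h2]

theorem growthIndex_of_not (h : ¬ ∃ b ∈ blocks l, b.1 < p ∧ p ≤ b.2) :
    growthIndex l p = (blocks l).card := by
  rw [growthIndex, dif_neg h]

theorem length_of_mem_stirlingPerms (hl : l ∈ stirlingPerms k n) : l.length = k * n := by
  have hsub : l.toFinset ⊆ Finset.Icc 1 n := by
    intro j hj
    have := hl.1 j
    have h0 := List.count_pos_iff.2 (List.mem_toFinset.1 hj)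
    simp only [Finset.mem_Icc]
    grind
  rw [← List.sum_toFinset_count_eq_length, Finset.sum_subset hsub]
  · rw [Finset.sum_congr rfl (g := fun _ => k)]
    · simp [mul_comm]
    · intro j hj
      rw [hl.1, if_pos (by simpa using hj)]
  · intro j _ hj
    rw [List.count_eq_zero]
    simpa using hj

theorem le_of_mem_stirlingPerms (hl : l ∈ stirlingPerms k n) {j : ℕ} (hj : j ∈ l) : j ≤ n := by
  have := hl.1 j
  have h0 := List.count_pos_iff.2 hj
  grind

/-- The block `b`, given by its first and last positions, after a string of length `k` has been
inserted at gap `p`. -/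
def blockShift (k p : ℕ) (b : ℕ × ℕ) : ℕ × ℕ := (gapShift k p b.1, gapShift k p b.2)

theorem blockShift_injective (k p : ℕ) : Function.Injective (blockShift k p) := by
  intro b c h
  have h' := Prod.mk.inj h
  exact Prod.ext ((gapShift_strictMono k p).injective h'.1)
    ((gapShift_strictMono k p).injective h'.2)

open Classical in
theorem blocks_insertRun (hk : 0 < k) (hl : l ∈ stirlingPerms k n) (hp : p ≤ l.length) :
    blocks (insertRun k (n + 1) p l) = (blocks l).image (blockShift k p) ∪
      if ∃ b ∈ blocks l, b.1 < p ∧ p ≤ b.2 then ∅ else {(p, p + k - 1)} := by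
  have ha : n + 1 ∉ l := fun h => by have := le_of_mem_stirlingPerms hl h; omega
  ext c
  rw [mem_blocks_insertRun hk hp ha, Finset.mem_union]
  apply or_congr
  · simp only [Finset.mem_image, blockShift, eq_comm]
  · split_ifs with h
    · exact iff_of_false (fun h' => h'.1 h) (by simp)
    · rw [Finset.mem_singleton]; exact and_iff_right h

theorem blockLabel_blockShift (hp : p ≤ l.length) (a : ℕ) (b : ℕ × ℕ) :
    blockLabel (insertRun k a p l) (blockShift k p b) = blockLabel l b := by
  simp only [blockLabel, blockShift, List.getD_eq_getElem?_getD, getElem?_insertRun_gapShift hp]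

theorem blockLabel_run (hk : 0 < k) (hp : p ≤ l.length) (a : ℕ) :
    blockLabel (insertRun k a p l) (p, p + k - 1) = a := by
  simp only [blockLabel, List.getD_eq_getElem?_getD]
  rw [getElem?_insertRun_run hp le_rfl (by omega)]; rfl

theorem blockShift_ne_run (hk : 0 < k) (b : ℕ × ℕ) : blockShift k p b ≠ (p, p + k - 1) := by
  intro h
  have := (Prod.mk.inj h).1
  unfold gapShift at this
  grind

theorem blockRank_blockShift (hk : 0 < k) (hl : l ∈ stirlingPerms k n) (hp : p ≤ l.length)
    {b : ℕ × ℕ} (hb : b ∈ blocks l) :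
    blockRank (insertRun k (n + 1) p l) (blockShift k p b) = blockRank l b := by
  classical
  -- a new run has a larger label than every old block, so it does not count
  rw [blockRank, blockRank, blocks_insertRun hk hl hp, Finset.filter_union, Finset.union_eq_left.2,
    Finset.filter_image, Finset.card_image_of_injective _ (blockShift_injective k p)]
  · simp only [blockLabel_blockShift hp]
  · have := le_of_mem_stirlingPerms hl (blockLabel_mem hb)
    rw [Finset.filter_eq_empty_iff.2]
    · simp
    · intro c hc
      split_ifs at hc
      · simp at hc
      · rw [Finset.mem_singleton.1 hc, blockLabel_run hk hp, blockLabel_blockShift hp]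
        omega

theorem blockRank_run (hk : 0 < k) (hl : l ∈ stirlingPerms k n) (hp : p ≤ l.length)
    (h : ¬ ∃ b ∈ blocks l, b.1 < p ∧ p ≤ b.2) :
    blockRank (insertRun k (n + 1) p l) (p, p + k - 1) = (blocks l).card := by
  classical
  rw [blockRank, blocks_insertRun hk hl hp, if_neg h, Finset.filter_union, Finset.filter_image,
    Finset.filter_eq_self.2, Finset.filter_eq_empty_iff.2, Finset.union_empty,
    Finset.card_image_of_injective _ (blockShift_injective k p)]
  · intro c hc
    rw [Finset.mem_singleton.1 hc]
    exact lt_irrefl _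
  · intro c hc
    have := le_of_mem_stirlingPerms hl (blockLabel_mem hc)
    rw [blockLabel_run hk hp, blockLabel_blockShift hp]
    omega

theorem card_blocks_insertRun (hk : 0 < k) (hl : l ∈ stirlingPerms k n) (hp : p ≤ l.length) :
    (blocks (insertRun k (n + 1) p l)).card =
      (blocks l).card + if growthIndex l p = (blocks l).card then 1 else 0 := by
  classical
  rw [blocks_insertRun hk hl hp]
  split_ifs with h h' h'
  · obtain ⟨b, hb, h1, h2⟩ := h
    rw [growthIndex_of_mem hl hb h1 h2] at h'
    exact absurd h' (blockRank_lt hb).ne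
  · rw [Finset.union_empty, Finset.card_image_of_injective _ (blockShift_injective k p), add_zero]
  · rw [Finset.card_union_of_disjoint, Finset.card_image_of_injective _ (blockShift_injective k p),
      Finset.card_singleton]
    rw [Finset.disjoint_singleton_right, Finset.mem_image]
    rintro ⟨b, -, hb⟩
    exact blockShift_ne_run hk b hb
  · exact absurd (growthIndex_of_not h) h'

/-- Inserting a run of a new letter makes exactly one block grow by `k`, where a new block counts
as growing from size `0`. -/
theorem blockSize_insertRun (hk : 0 < k) (hl : l ∈ stirlingPerms k n) (hp : p ≤ l.length) (m : ℕ) :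
    blockSize (insertRun k (n + 1) p l) m =
      blockSize l m + if growthIndex l p = m then k else 0 := by
  classical
  have hdisj : Disjoint ((blocks l).image (blockShift k p))
      (if ∃ b ∈ blocks l, b.1 < p ∧ p ≤ b.2 then ∅ else {(p, p + k - 1)}) := by
    split_ifs
    · simp
    rw [Finset.disjoint_singleton_right, Finset.mem_image]
    rintro ⟨b, -, hb⟩
    exact blockShift_ne_run hk b hb
  rw [blockSize_eq_sum, blocks_insertRun hk hl hp, Finset.sum_union hdisj,
    Finset.sum_image (blockShift_injective k p).injOn, blockSize_eq_sum]
  have hsize : ∀ b ∈ blocks l, (if blockRank (insertRun k (n + 1) p l) (blockShift k p b) = m then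
      (blockShift k p b).2 - (blockShift k p b).1 + 1 else 0) =
      (if blockRank l b = m then b.2 - b.1 + 1 else 0) +
        if b.1 < p ∧ p ≤ b.2 then (if blockRank l b = m then k else 0) else 0 := by
    intro b hb
    have h1 := (mem_blocks.1 hb).1
    rw [blockRank_blockShift hk hl hp hb]
    simp only [blockShift, gapShift]
    grind
  rw [Finset.sum_congr rfl hsize, Finset.sum_add_distrib, add_assoc]
  congr 1
  split_ifs with h1 h2 h2
  · obtain ⟨b, hb, hb1, hb2⟩ := h1
    rw [growthIndex_of_mem hl hb hb1 hb2] at h2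
    rw [Finset.sum_eq_single_of_mem b hb, if_pos ⟨hb1, hb2⟩, if_pos h2, Finset.sum_empty, add_zero]
    intro c hc hcb
    exact if_neg fun h => hcb (blocks_eq_of_overlap hl hc hb h.1.le h.2 hb1.le hb2)
  · obtain ⟨b, hb, hb1, hb2⟩ := h1
    rw [growthIndex_of_mem hl hb hb1 hb2] at h2
    rw [Finset.sum_eq_single_of_mem b hb, if_pos ⟨hb1, hb2⟩, if_neg h2, Finset.sum_empty, add_zero]
    intro c hc hcb
    exact if_neg fun h => hcb (blocks_eq_of_overlap hl hc hb h.1.le h.2 hb1.le hb2)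
  all_goals
    rw [growthIndex_of_not h1] at h2
    rw [Finset.sum_eq_zero fun b hb => if_neg fun h => h1 ⟨b, hb, h⟩, Finset.sum_singleton,
      blockRank_run hk hl hp h1]
  · rw [if_pos h2]
    omega
  · rw [if_neg h2]

/-- The blocks of a Stirling permutation partition its positions. -/
theorem sum_blockSize (hl : l ∈ stirlingPerms k n) {M : ℕ} (hM : (blocks l).card ≤ M) :
    ∑ m ∈ Finset.range M, blockSize l m = k * n := by
  simp only [blockSize_eq_sum]
  rw [Finset.sum_comm, ← length_of_mem_stirlingPerms hl]
  have h1 : ∀ b ∈ blocks l, (∑ m ∈ Finset.range M, if blockRank l b = m then b.2 - b.1 + 1 else 0) =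
      (Finset.Icc b.1 b.2).card := by
    intro b hb
    have := (mem_blocks.1 hb).1
    rw [Finset.sum_ite_eq, if_pos (by simpa using (blockRank_lt hb).trans_le hM), Nat.card_Icc]
    omega
  rw [Finset.sum_congr rfl h1, ← Finset.card_biUnion, ← Finset.card_range l.length]
  · congr 1
    ext x
    simp only [Finset.mem_biUnion, Finset.mem_Icc, Finset.mem_range]
    constructor
    · rintro ⟨b, hb, h⟩
      exact h.2.trans_lt (mem_blocks.1 hb).2.1
    · exact fun hx => exists_block_of_getElem?_eq le_rfl hx rfl
  · intro b hb c hc hbc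
    refine Finset.disjoint_left.2 fun x hx hx' => ?_
    rw [Finset.mem_Icc] at hx hx'
    exact hbc (blocks_eq_of_overlap hl hb hc hx.1 hx.2 hx'.1 hx'.2)

/-- A block of size `s` is enlarged by the insertions at its `s - 1` inner gaps. -/
theorem card_growthIndex_eq (hl : l ∈ stirlingPerms k n) {m : ℕ} (hm : m < (blocks l).card) :
    (Finset.univ.filter fun p : Fin (k * n + 1) => growthIndex l p = m).card + 1
      = blockSize l m := by
  obtain ⟨b, hb, rfl⟩ := exists_blockRank_eq hm
  obtain ⟨h1, h2, -⟩ := mem_blocks.1 hb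
  rw [length_of_mem_stirlingPerms hl] at h2
  have : (Finset.univ.filter fun p : Fin (k * n + 1) => growthIndex l p = blockRank l b) =
      Finset.Ioc (⟨b.1, by omega⟩ : Fin (k * n + 1)) ⟨b.2, by omega⟩ := by
    ext p
    simp only [Finset.mem_filter, Finset.mem_univ, true_and, Finset.mem_Ioc, Fin.lt_def, Fin.le_def]
    constructor
    · intro h
      by_cases hex : ∃ b ∈ blocks l, b.1 < (p : ℕ) ∧ p ≤ b.2
      · obtain ⟨c, hc, hc1, hc2⟩ := hex
        rw [growthIndex_of_mem hl hc hc1 hc2] at h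
        rw [← blockRank_injOn l hc hb h]
        exact ⟨hc1, hc2⟩
      · rw [growthIndex_of_not hex] at h
        exact absurd h (blockRank_lt hb).ne'
    · exact fun h => growthIndex_of_mem hl hb h.1 h.2
  rw [this, blockSize_blockRank hb, Fin.card_Ioc]

theorem growthIndex_le (hl : l ∈ stirlingPerms k n) (p : ℕ) :
    growthIndex l p ≤ (blocks l).card := by
  by_cases hex : ∃ b ∈ blocks l, b.1 < (p : ℕ) ∧ p ≤ b.2
  · obtain ⟨c, hc, hc1, hc2⟩ := hex
    rw [growthIndex_of_mem hl hc hc1 hc2]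
    exact (blockRank_lt hc).le
  · exact (growthIndex_of_not hex).le

theorem growthIndex_zero (l : List ℕ) : growthIndex l 0 = (blocks l).card :=
  growthIndex_of_not (by simp)

end Insert

/-! ### Rising factorial ratios and Pólya urns -/

/-- The ratio `x (x + k) ⋯ (x + (a - 1) k) / (y (y + k) ⋯ (y + (a - 1) k))` of rising factorials
with step `k`. -/
noncomputable def risingRatio (k x y : ℝ) (a : ℕ) : ℝ :=
  ∏ i ∈ Finset.range a, (x + k * i) / (y + k * i)

theorem mul_prod_add_step (k x : ℝ) (a : ℕ) :
    x * ∏ i ∈ Finset.range a, (x + k + k * i) =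
      (∏ i ∈ Finset.range a, (x + k * i)) * (x + k * a) := by
  have h := Finset.prod_range_succ' (fun i : ℕ => x + k * i) a
  rw [Finset.prod_range_succ] at h
  rw [h]
  push_cast
  rw [mul_zero, add_zero, mul_comm]
  congr 1
  exact Finset.prod_congr rfl fun i _ => by ring

/-- One draw from a Pólya urn with weights `x` and `y - x`, in which the drawn weight is increased
by `k`, preserves the mean of `risingRatio`. -/
theorem risingRatio_step {k y : ℝ} (hk : 0 ≤ k) (hy : 0 < y) (x : ℝ) (a : ℕ) :
    x * risingRatio k (x + k) (y + k) a + (y - x) * risingRatio k x (y + k) a =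
      y * risingRatio k x y a := by
  simp only [risingRatio, Finset.prod_div_distrib]
  have hx := mul_prod_add_step k x a
  have hy' := mul_prod_add_step k y a
  have h1 : 0 < ∏ i ∈ Finset.range a, (y + k + k * i) :=
    Finset.prod_pos fun i _ => by positivity
  have h2 : 0 < ∏ i ∈ Finset.range a, (y + k * i) :=
    Finset.prod_pos fun i _ => by positivity
  rw [mul_div_assoc', mul_div_assoc', mul_div_assoc', ← add_div, hx,
    div_eq_div_iff h1.ne' h2.ne']
  linear_combination (-∏ i ∈ Finset.range a, (x + k * i)) * hy'

theorem risingRatio_mem_Icc {k x y : ℝ} (hk : 0 ≤ k) (hx : 0 ≤ x) (hxy : x ≤ y) (a : ℕ) :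
    risingRatio k x y a ∈ Set.Icc 0 1 := by
  have hy := hx.trans hxy
  refine ⟨Finset.prod_nonneg fun i _ => by positivity, Finset.prod_le_one
    (fun i _ => by positivity) fun i _ => div_le_one_of_le₀ (by linarith) (by positivity)⟩

/-- The letters that lie outside the first `m` blocks, when the block sizes of a word with `k * n`
letters are `c 0, c 1, …`. -/
def tailSize (k n : ℕ) (c : ℕ → ℕ) (m : ℕ) : ℝ := (k : ℝ) * n - ∑ i ∈ Finset.range m, (c i : ℝ)

/-- The contribution of block `m` to the urn functional: the urn that decides between block `m` and
the later ones has weights `c m - 1` and `tailSize (m + 1) + m + 2`. Before the block exists, the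
contribution is that of the urn right after the creation of the block, of size `k`. -/
noncomputable def urnFactor (k n : ℕ) (c : ℕ → ℕ) (a m : ℕ) : ℝ :=
  if c m = 0 then risingRatio k (k - 1) (k + m + 1) a
  else risingRatio k (c m - 1) (tailSize k n c m + m + 1) a

/-- The block sizes after block `j` has grown by `k`. -/
def growAt (k : ℕ) (c : ℕ → ℕ) (j : ℕ) : ℕ → ℕ := fun m => c m + if j = m then k else 0

theorem tailSize_succ (k n : ℕ) (c : ℕ → ℕ) (m : ℕ) :
    tailSize k n c (m + 1) = tailSize k n c m - c m := by
  simp only [tailSize, Finset.sum_range_succ]; ring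

theorem tailSize_growAt (k n : ℕ) (c : ℕ → ℕ) (j m : ℕ) :
    tailSize k (n + 1) (growAt k c j) m = tailSize k n c m + if m ≤ j then (k : ℝ) else 0 := by
  simp only [tailSize, growAt]
  push_cast
  rw [Finset.sum_add_distrib, Finset.sum_ite_eq]
  simp only [Finset.mem_range]
  split_ifs <;> first | omega | ring

theorem urnFactor_growAt_lt (k n : ℕ) (c : ℕ → ℕ) (a : ℕ) {j m : ℕ} (h : j < m) :
    urnFactor k (n + 1) (growAt k c j) a m = urnFactor k n c a m := by
  simp only [urnFactor, tailSize_growAt, if_neg h.not_ge, add_zero]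
  simp only [growAt, if_neg h.ne, add_zero]

/-- Averaging over the gaps with growth index at least `m` preserves the part of the urn functional
that belongs to the blocks from `m` on. -/
theorem sum_prod_urnFactor {k n B : ℕ} {c : ℕ → ℕ} {J : Fin (k * n + 1) → ℕ} (hk : 0 < k)
    (hpos : ∀ m < B, 0 < c m) (hzero : ∀ m, B ≤ m → c m = 0)
    (hsum : ∑ m ∈ Finset.range B, c m = k * n) (hJ : ∀ p, J p ≤ B)
    (hcard : ∀ m < B, (Finset.univ.filter fun p => J p = m).card + 1 = c m)
    (a : ℕ → ℕ) (M m : ℕ) :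
    ∑ p with m ≤ J p, ∏ i ∈ Finset.Ico m M, urnFactor k (n + 1) (growAt k c (J p)) (a i) i =
      (Finset.univ.filter fun p => m ≤ J p).card *
        ∏ i ∈ Finset.Ico m M, urnFactor k n c (a i) i := by
  have hsplit : ∀ m, (Finset.univ.filter fun p => m ≤ J p) =
      (Finset.univ.filter fun p => J p = m) ∪ (Finset.univ.filter fun p => m + 1 ≤ J p) := by
    intro m; ext p; simp; omega
  have hdisj : ∀ m, Disjoint (Finset.univ.filter fun p => J p = m)
      (Finset.univ.filter fun p => m + 1 ≤ J p) := by
    intro m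
    refine Finset.disjoint_filter.2 fun p _ h => by omega
  -- the total weight of urn `m`
  have hW : ∀ m ≤ B, ((Finset.univ.filter fun p => m ≤ J p).card : ℝ) =
      tailSize k n c m + m + 1 := by
    intro m hm
    induction m with
    | zero => simp [tailSize]
    | succ m ih =>
      have h1 := ih (by omega)
      rw [hsplit, Finset.card_union_of_disjoint (hdisj m)] at h1
      have h2 := hcard m (by omega)
      rw [tailSize_succ, ← h2]
      push_cast at h1 ⊢
      linarith
  have htail : ∀ m, B ≤ m → tailSize k n c m = 0 := by
    intro m hm
    rw [tailSize, sub_eq_zero]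
    have h := Finset.sum_subset (f := c) (Finset.range_subset_range.2 hm) fun x _ hx =>
      hzero x (by simpa using hx)
    rw [hsum] at h
    exact_mod_cast h
  suffices ∀ d m, m + d = M ∨ M ≤ m → ∑ p with m ≤ J p,
      ∏ i ∈ Finset.Ico m M, urnFactor k (n + 1) (growAt k c (J p)) (a i) i =
      (Finset.univ.filter fun p => m ≤ J p).card *
        ∏ i ∈ Finset.Ico m M, urnFactor k n c (a i) i from
    this (M - m) m (by omega)
  intro d
  induction d with
  | zero =>
    intro m hm
    rw [Finset.Ico_eq_empty (by omega)]
    simp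
  | succ d ih =>
    intro m hm
    rcases le_or_gt M m with hMm | hMm
    · rw [Finset.Ico_eq_empty (by omega)]
      simp
    have ih := ih (m + 1) (by omega)
    rw [hsplit, Finset.sum_union (hdisj m), Finset.card_union_of_disjoint (hdisj m)]
    simp only [Finset.prod_eq_prod_Ico_succ_bot hMm]
    set G := ∏ i ∈ Finset.Ico (m + 1) M, urnFactor k n c (a i) i
    -- a draw of block `m` leaves the later urns alone
    have h1 : ∑ p with J p = m, urnFactor k (n + 1) (growAt k c (J p)) (a m) m *
        ∏ i ∈ Finset.Ico (m + 1) M, urnFactor k (n + 1) (growAt k c (J p)) (a i) i =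
        (Finset.univ.filter fun p => J p = m).card *
          (urnFactor k (n + 1) (growAt k c m) (a m) m * G) := by
      rw [← nsmul_eq_mul, ← Finset.sum_const]
      refine Finset.sum_congr rfl fun p hp => ?_
      rw [(Finset.mem_filter.1 hp).2]
      congr 1
      exact Finset.prod_congr rfl fun i hi => urnFactor_growAt_lt _ _ _ _ (by simp at hi; omega)
    -- a draw of a later block changes urn `m` in a way that does not depend on the block
    have h2 : ∑ p with m + 1 ≤ J p, urnFactor k (n + 1) (growAt k c (J p)) (a m) m *
        ∏ i ∈ Finset.Ico (m + 1) M, urnFactor k (n + 1) (growAt k c (J p)) (a i) i =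
        (Finset.univ.filter fun p => m + 1 ≤ J p).card *
          (urnFactor k (n + 1) (growAt k c (m + 1)) (a m) m * G) := by
      rw [mul_left_comm, ← ih, Finset.mul_sum]
      refine Finset.sum_congr rfl fun p hp => ?_
      have hp := (Finset.mem_filter.1 hp).2
      congr 1
      simp only [urnFactor, tailSize_growAt, if_pos (by omega : m ≤ J p),
        if_pos (by omega : m ≤ m + 1)]
      simp only [growAt, if_neg (by omega : ¬ J p = m), if_neg (by omega : ¬ m + 1 = m)]
    rw [h1, h2, ← mul_assoc, ← mul_assoc, ← mul_assoc, ← add_mul]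
    congr 1
    push_cast
    rcases lt_trichotomy m B with hmB | hmB | hmB
    · have hc := hcard m hmB
      have e1 : ((Finset.univ.filter fun p => J p = m).card : ℝ) = c m - 1 := by
        rw [← hc]; push_cast; ring
      have e2 := hW (m + 1) hmB
      rw [tailSize_succ] at e2
      have hc0 : c m ≠ 0 := (hpos m hmB).ne'
      have ht : 0 < tailSize k n c m + m + 1 := by
        have h3 := hW m hmB.le
        rw [hsplit, Finset.card_union_of_disjoint (hdisj m)] at h3
        push_cast at h3
        have : (0 : ℝ) ≤ tailSize k n c (m + 1) := by
          have h5 := Finset.sum_le_sum_of_subset (f := c)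
            (Finset.range_subset_range.2 (by omega : m + 1 ≤ B))
          rw [hsum] at h5
          rw [tailSize, sub_nonneg]
          exact_mod_cast h5
        rw [tailSize_succ] at this
        have : (0 : ℝ) ≤ c m := by positivity
        have : (0 : ℝ) ≤ m := by positivity
        linarith
      have key := risingRatio_step (k := k) (by positivity) ht ((c m : ℝ) - 1) (a m)
      simp only [urnFactor, tailSize_growAt, if_pos le_rfl, if_pos (by omega : m ≤ m + 1), hc0,
        if_false]
      simp only [growAt, if_true, if_neg (by omega : ¬ m + 1 = m), add_zero, hc0, if_false,
        if_neg (by omega : ¬ c m + k = 0), e1, e2]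
      push_cast
      ring_nf at key ⊢
      linarith
    -- every draw creates block `m`, of size `k`, and its contribution does not change
    · have e2 : (Finset.univ.filter fun p => m + 1 ≤ J p).card = 0 := by
        rw [Finset.card_eq_zero, Finset.filter_eq_empty_iff]
        intro p _ h
        have := hJ p
        omega
      have hc0 := hzero m hmB.ge
      rw [e2]
      simp only [urnFactor, tailSize_growAt, htail m hmB.ge, if_pos le_rfl, hc0]
      simp only [growAt, hc0, if_true, zero_add, hk.ne', if_false]
      simp
    · have e1 : (Finset.univ.filter fun p => J p = m).card = 0 := by
        rw [Finset.card_eq_zero, Finset.filter_eq_empty_iff]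
        intro p _ h
        have := hJ p
        omega
      have e2 : (Finset.univ.filter fun p => m + 1 ≤ J p).card = 0 := by
        rw [Finset.card_eq_zero, Finset.filter_eq_empty_iff]
        intro p _ h
        have := hJ p
        omega
      rw [e1, e2]
      simp

/-! ### The urn martingales -/

/-- The functional of a word of order `n` that is a martingale along the random growth: the product
of the urn contributions of the first `M` blocks, block `i` with exponent `a i`. -/
noncomputable def urnProd (k : ℕ) (a : ℕ → ℕ) (M n : ℕ) (l : List ℕ) : ℝ :=
  ∏ i ∈ Finset.range M, urnFactor k n (blockSize l) (a i) i

theorem blockSize_insertRun_eq_growAt {k n p : ℕ} {l : List ℕ} (hk : 0 < k)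
    (hl : l ∈ stirlingPerms k n) (hp : p ≤ l.length) :
    blockSize (insertRun k (n + 1) p l) = growAt k (blockSize l) (growthIndex l p) :=
  funext fun m => blockSize_insertRun hk hl hp m

theorem sum_urnProd_insertRun {k n : ℕ} {l : List ℕ} (hk : 0 < k) (hl : l ∈ stirlingPerms k n)
    (a : ℕ → ℕ) (M : ℕ) :
    ∑ p : Fin (k * n + 1), urnProd k a M (n + 1) (insertRun k (n + 1) p l) =
      (k * n + 1) * urnProd k a M n l := by
  have h := sum_prod_urnFactor (c := blockSize l) (B := (blocks l).card) (n := n)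
    (J := fun p : Fin (k * n + 1) => growthIndex l p) hk (fun m hm => blockSize_pos hm)
    (fun m hm => blockSize_eq_zero hm) (sum_blockSize hl le_rfl) (fun p => growthIndex_le hl p)
    (fun m hm => card_growthIndex_eq hl hm) a M 0
  simp only [zero_le, Finset.filter_true, ← Finset.range_eq_Ico, Finset.card_univ,
    Fintype.card_fin] at h
  push_cast at h
  rw [urnProd, ← h]
  refine Finset.sum_congr rfl fun p _ => ?_
  rw [urnProd, blockSize_insertRun_eq_growAt hk hl]
  rw [length_of_mem_stirlingPerms hl]
  omega

theorem sum_blockSize_le {k n : ℕ} {l : List ℕ} (hl : l ∈ stirlingPerms k n) (m : ℕ) :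
    ∑ i ∈ Finset.range m, blockSize l i ≤ k * n := by
  rw [← sum_blockSize hl (le_max_left (blocks l).card m)]
  exact Finset.sum_le_sum_of_subset (Finset.range_subset_range.2 (le_max_right _ _))

theorem tailSize_nonneg {k n : ℕ} {l : List ℕ} (hl : l ∈ stirlingPerms k n) (m : ℕ) :
    0 ≤ tailSize k n (blockSize l) m := by
  rw [tailSize, sub_nonneg]
  exact_mod_cast sum_blockSize_le hl m

theorem blockSize_le_tailSize {k n : ℕ} {l : List ℕ} (hl : l ∈ stirlingPerms k n) (m : ℕ) :
    (blockSize l m : ℝ) ≤ tailSize k n (blockSize l) m := by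
  have := tailSize_nonneg hl (m + 1)
  rw [tailSize_succ] at this
  linarith

theorem urnFactor_mem_Icc {k n : ℕ} {l : List ℕ} (hk : 0 < k) (hl : l ∈ stirlingPerms k n)
    (a m : ℕ) : urnFactor k n (blockSize l) a m ∈ Set.Icc 0 1 := by
  have hm : (0 : ℝ) ≤ m := by positivity
  have h1 : (1 : ℝ) ≤ k := by exact_mod_cast hk
  rw [urnFactor]
  split_ifs with h
  · exact risingRatio_mem_Icc (by positivity) (by linarith) (by linarith) a
  · have h2 : (1 : ℝ) ≤ blockSize l m := by exact_mod_cast Nat.one_le_iff_ne_zero.2 h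
    have := blockSize_le_tailSize hl m
    exact risingRatio_mem_Icc (by positivity) (by linarith) (by linarith) a

theorem urnProd_mem_Icc {k n : ℕ} {l : List ℕ} (hk : 0 < k) (hl : l ∈ stirlingPerms k n)
    (a : ℕ → ℕ) (M : ℕ) : urnProd k a M n l ∈ Set.Icc 0 1 :=
  ⟨Finset.prod_nonneg fun i _ => (urnFactor_mem_Icc hk hl _ i).1,
    Finset.prod_le_one (fun i _ => (urnFactor_mem_Icc hk hl _ i).1)
      fun i _ => (urnFactor_mem_Icc hk hl _ i).2⟩

section Growth

variable {Ω : Type*} [MeasurableSpace Ω] {P : Measure Ω} {k : ℕ} {g : (n : ℕ) → Ω → Fin (k * n + 1)}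

/-- The history of the growth: `gapFiltration hgm n` is generated by the gaps chosen before the
word of order `n` is reached. -/
def gapFiltration (hgm : ∀ n, Measurable (g n)) : Filtration ℕ (‹MeasurableSpace Ω›) where
  seq n := ⨆ i ∈ {i | i < n}, MeasurableSpace.comap (g i) inferInstance
  mono' _ _ h := biSup_mono fun _ hi => lt_of_lt_of_le hi h
  le' _ := iSup₂_le fun i _ => (hgm i).comap_le

theorem measurable_comp_stirlingGrowth (hgm : ∀ n, Measurable (g n)) (n : ℕ) (f : List ℕ → ℝ) :
    Measurable[gapFiltration hgm n] fun ω => f (stirlingGrowth k (fun i => g i ω) n) := by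
  let : MeasurableSpace (List ℕ) := ⊤
  have : DiscreteMeasurableSpace (List ℕ) := ⟨fun _ => trivial⟩
  suffices ∀ n, Measurable[gapFiltration hgm n] fun ω => stirlingGrowth k (fun i => g i ω) n from
    (Measurable.of_discrete (f := f)).comp (this n)
  intro n
  induction n with
  | zero => exact measurable_const
  | succ n ih =>
    have h1 : Measurable[gapFiltration hgm (n + 1)] (g n) := by
      rw [measurable_iff_comap_le]
      exact le_iSup₂ (f := fun i (_ : i ∈ {i | i < n + 1}) =>
        MeasurableSpace.comap (g i) inferInstance) n (Nat.lt_succ_self n)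
    have h2 := ih.mono ((gapFiltration hgm).mono n.le_succ) le_rfl
    exact (Measurable.of_discrete (f := fun q : List ℕ × Fin (k * n + 1) =>
      insertRun k (n + 1) q.2 q.1)).comp (h2.prodMk h1)

theorem measure_gap_eq [IsProbabilityMeasure P] (hgm : ∀ n, Measurable (g n))
    (hg : ∀ n, HasLaw (g n) (uniformOn (Set.univ : Set (Fin (k * n + 1)))) P) (n : ℕ)
    (p : Fin (k * n + 1)) : P (g n ⁻¹' {p}) = (k * n + 1 : ENNReal)⁻¹ := by
  rw [← Measure.map_apply (hgm n) (measurableSet_singleton p), (hg n).map_eq, uniformOn_univ]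
  simp

/-- A bounded function of the word that is preserved on average by inserting at a uniform gap is a
martingale along the random growth. -/
theorem martingale_of_sum_insertRun [IsProbabilityMeasure P] (hgm : ∀ n, Measurable (g n))
    (hg : ∀ n, HasLaw (g n) (uniformOn (Set.univ : Set (Fin (k * n + 1)))) P)
    (hindep : iIndepFun g P) {f : ℕ → List ℕ → ℝ}
    (hf : ∀ n, ∀ l ∈ stirlingPerms k n, f n l ∈ Set.Icc 0 1)
    (hsum : ∀ n, ∀ l ∈ stirlingPerms k n,
      ∑ p : Fin (k * n + 1), f (n + 1) (insertRun k (n + 1) p l) = (k * n + 1) * f n l) :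
    Martingale (fun n ω => f n (stirlingGrowth k (fun i => g i ω) n)) (gapFiltration hgm) P := by
  have hle := (gapFiltration hgm).le
  have hbdd : ∀ n (h : List ℕ → ℝ), (∀ l ∈ stirlingPerms k n, h l ∈ Set.Icc 0 1) →
      Integrable (fun ω => h (stirlingGrowth k (fun i => g i ω) n)) P := by
    intro n h hh
    refine Integrable.of_bound ((measurable_comp_stirlingGrowth hgm n h).mono (hle n)
      le_rfl).aestronglyMeasurable 1 (ae_of_all _ fun ω => ?_)
    have := hh _ (stirlingGrowth_mem k (fun i => g i ω) n)
    rw [Real.norm_eq_abs, abs_le]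
    exact ⟨by linarith [this.1], this.2⟩
  refine martingale_nat (fun n => (measurable_comp_stirlingGrowth hgm n _).stronglyMeasurable)
    (fun n => hbdd n _ (hf n)) fun n => ?_
  -- splitting along the value of the next gap separates it from the history
  have hpt : (fun ω => f (n + 1) (stirlingGrowth k (fun i => g i ω) (n + 1))) =
      ∑ p : Fin (k * n + 1), (fun ω => f (n + 1) (insertRun k (n + 1) p
        (stirlingGrowth k (fun i => g i ω) n))) * (g n ⁻¹' {p}).indicator (fun _ => (1 : ℝ)) := by
    ext ω
    rw [Finset.sum_apply, Finset.sum_eq_single_of_mem (g n ω) (Finset.mem_univ _)]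
    · simp [stirlingGrowth]
    · intro p _ hp
      simp [hp.symm]
  have hins : ∀ p : Fin (k * n + 1), Integrable (fun ω => f (n + 1) (insertRun k (n + 1) p
        (stirlingGrowth k (fun i => g i ω) n))) P := fun p =>
    hbdd n (fun l => f (n + 1) (insertRun k (n + 1) p l)) fun l hl =>
      hf _ _ (insertRun_mem_stirlingPerms hl p)
  have hset : ∀ p : Fin (k * n + 1), MeasurableSet (g n ⁻¹' {p}) := fun p =>
    hgm n (measurableSet_singleton p)
  have hmulint : ∀ p : Fin (k * n + 1), Integrable ((fun ω => f (n + 1) (insertRun k (n + 1) p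
        (stirlingGrowth k (fun i => g i ω) n))) *
          (g n ⁻¹' {p}).indicator (fun _ => (1 : ℝ))) P := by
    intro p
    have : ((fun ω => f (n + 1) (insertRun k (n + 1) p (stirlingGrowth k (fun i => g i ω) n))) *
        (g n ⁻¹' {p}).indicator (fun _ => (1 : ℝ))) = (g n ⁻¹' {p}).indicator
        (fun ω => f (n + 1) (insertRun k (n + 1) p (stirlingGrowth k (fun i => g i ω) n))) := by
      ext ω
      by_cases h : ω ∈ g n ⁻¹' {p} <;> simp [h]
    rw [this]
    exact (hins p).indicator (hset p)
  rw [hpt]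
  have hcond : ∀ p : Fin (k * n + 1), P[(fun ω => f (n + 1) (insertRun k (n + 1) p
        (stirlingGrowth k (fun i => g i ω) n))) * (g n ⁻¹' {p}).indicator (fun _ => (1 : ℝ)) |
        gapFiltration hgm n] =ᵐ[P] fun ω => f (n + 1) (insertRun k (n + 1) p
        (stirlingGrowth k (fun i => g i ω) n)) * (k * n + 1 : ℝ)⁻¹ := by
    intro p
    have hind : Indep (MeasurableSpace.comap (g n) inferInstance) (gapFiltration hgm n) P := by
      have := indep_iSup_of_disjoint (fun i => (hgm i).comap_le) hindep
        (by simp : Disjoint ({n} : Set ℕ) {i | i < n})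
      rwa [iSup_singleton] at this
    have h1 := condExp_mul_of_stronglyMeasurable_left (m := gapFiltration hgm n) (μ := P)
      ((measurable_comp_stirlingGrowth hgm n
        (fun l => f (n + 1) (insertRun k (n + 1) p l))).stronglyMeasurable) (hmulint p)
      ((integrable_const (1 : ℝ)).indicator (hset p))
    have h2 := condExp_indep_eq (hgm n).comap_le (hle n)
      (f := (g n ⁻¹' {p}).indicator (fun _ => (1 : ℝ))) (μ := P)
      (stronglyMeasurable_const.indicator ⟨{p}, measurableSet_singleton p, rfl⟩) hind
    filter_upwards [h1, h2] with ω hω1 hω2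
    rw [hω1, Pi.mul_apply, hω2, integral_indicator_const _ (hset p), Measure.real,
      measure_gap_eq hgm hg n p]
    simp only [smul_eq_mul, mul_one]
    congr 1
    rw [ENNReal.toReal_inv]
    norm_cast
  have hall : ∀ᵐ ω ∂P, ∀ p : Fin (k * n + 1), _ := ae_all_iff.2 hcond
  filter_upwards [condExp_finsetSum (s := Finset.univ) (fun p _ => hmulint p)
    (gapFiltration hgm n), hall] with ω h1 h2
  rw [h1, Finset.sum_apply, Finset.sum_congr rfl fun p _ => h2 p, ← Finset.sum_mul,
    hsum n _ (stirlingGrowth_mem k _ n)]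
  have : (0 : ℝ) < k * n + 1 := by positivity
  field_simp

end Growth

/-! ### Determinacy of mixed moments -/

/-- The law of a sequence with values in the unit interval is determined by its mixed moments. -/
theorem Measure.ext_of_mixed_moments {μ ν : Measure (ℕ → unitInterval)} [IsProbabilityMeasure μ]
    [IsProbabilityMeasure ν]
    (h : ∀ (a : ℕ → ℕ) (M : ℕ), ∫ x, ∏ i ∈ Finset.range M, (x i : ℝ) ^ a i ∂μ =
      ∫ x, ∏ i ∈ Finset.range M, (x i : ℝ) ^ a i ∂ν) : μ = ν := by
  let coord : ℕ → BoundedContinuousFunction (ℕ → unitInterval) ℝ := fun i =>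
    BoundedContinuousFunction.mkOfCompact ⟨fun x => (x i : ℝ), by fun_prop⟩
  have hstar : ∀ f : BoundedContinuousFunction (ℕ → unitInterval) ℝ, star f = f := fun f =>
    BoundedContinuousFunction.ext fun x => star_trivial (f x)
  let A : StarSubalgebra ℝ (BoundedContinuousFunction (ℕ → unitInterval) ℝ) :=
    { Algebra.adjoin ℝ (Set.range coord) with
      star_mem' := fun {f} hf => by rwa [hstar f] }
  refine ext_of_forall_mem_subalgebra_integral_eq_of_polish (𝕜 := ℝ) (A := A) ?_ ?_
  · intro x y hxy
    obtain ⟨i, hi⟩ := Function.ne_iff.1 hxy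
    refine ⟨coord i, ⟨coord i, ⟨coord i, Algebra.subset_adjoin ⟨i, rfl⟩, rfl⟩, rfl⟩, ?_⟩
    exact fun h => hi (Subtype.ext h)
  · intro f hf
    replace hf : f ∈ Submodule.span ℝ (Submonoid.closure (Set.range coord) : Set
        (BoundedContinuousFunction (ℕ → unitInterval) ℝ)) := by
      rw [← Algebra.adjoin_eq_span]; exact hf
    -- the algebra is spanned by the monomials in the coordinates
    induction hf using Submodule.span_induction with
    | mem f hf =>
      have : ∃ a : ℕ →₀ ℕ, ∀ x, f x = a.prod fun i e => (x i : ℝ) ^ e := by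
        induction hf using Submonoid.closure_induction with
        | mem f hf =>
          obtain ⟨i, rfl⟩ := hf
          exact ⟨Finsupp.single i 1, fun x => by simp [coord]⟩
        | one => exact ⟨0, fun x => by simp⟩
        | mul f f' _ _ hf hf' =>
          obtain ⟨a, ha⟩ := hf
          obtain ⟨b, hb⟩ := hf'
          refine ⟨a + b, fun x => ?_⟩
          rw [Finsupp.prod_add_index' (by simp) fun i _ _ => pow_add _ _ _, ← ha, ← hb]
          rfl
      obtain ⟨a, ha⟩ := this
      obtain ⟨M, hM⟩ := a.support.exists_nat_subset_range
      have : ∀ x, f x = ∏ i ∈ Finset.range M, (x i : ℝ) ^ a i := fun x => by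
        rw [ha, Finsupp.prod_of_support_subset _ hM _ (by simp)]
      simp only [this]
      exact h a M
    | zero => simp
    | add f f' _ _ hf hf' =>
      simp only [BoundedContinuousFunction.coe_add, Pi.add_apply]
      rw [integral_add (f.integrable μ) (f'.integrable μ),
        integral_add (f.integrable ν) (f'.integrable ν), hf, hf']
    | smul c f _ hf =>
      simp only [BoundedContinuousFunction.coe_smul, integral_smul, hf]

/-! ### Moments of beta distributions -/

theorem beta_add_one_left {p q : ℝ} (hp : 0 < p) (hq : 0 < q) :
    beta (p + 1) q = beta p q * (p / (p + q)) := by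
  have h := Real.Gamma_pos_of_pos (add_pos hp hq)
  have h2 := add_pos hp hq
  rw [beta, beta, Real.Gamma_add_one hp.ne', add_right_comm, Real.Gamma_add_one h2.ne']
  field_simp

theorem beta_add_nat_left {p q : ℝ} (hp : 0 < p) (hq : 0 < q) (a : ℕ) :
    beta (p + a) q = beta p q * ∏ i ∈ Finset.range a, ((p + i) / (p + q + i)) := by
  induction a with
  | zero => simp
  | succ a ih =>
    push_cast
    rw [← add_assoc, beta_add_one_left (by positivity) hq, ih, Finset.prod_range_succ, mul_assoc,
      add_right_comm p q]

theorem ae_betaMeasure_mem_Ioo (p q : ℝ) : ∀ᵐ x ∂betaMeasure p q, x ∈ Set.Ioo (0 : ℝ) 1 := by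
  rw [betaMeasure, ae_withDensity_iff (by unfold betaPDF; fun_prop)]
  refine ae_of_all _ fun x hx => ?_
  by_contra h
  exact hx (by rw [betaPDF_eq, if_neg (show ¬ (0 < x ∧ x < 1) from h), ENNReal.ofReal_zero])

theorem integral_pow_betaMeasure {p q : ℝ} (hp : 0 < p) (hq : 0 < q) (a : ℕ) :
    ∫ x, x ^ a ∂betaMeasure p q = ∏ i ∈ Finset.range a, ((p + i) / (p + q + i)) := by
  have hpa : 0 < p + a := by positivity
  have hm : ∀ p, Measurable (betaPDF p q) := fun p => by unfold betaPDF; fun_prop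
  have h1 : ∫ x, (1 : ℝ) ∂betaMeasure (p + a) q = 1 := by
    have := isProbabilityMeasureBeta hpa hq
    simp
  have hfin : ∀ p, ∀ᵐ x : ℝ, betaPDF p q x < ⊤ := fun p => ae_of_all _ fun x =>
    ENNReal.ofReal_lt_top
  have hb := beta_add_nat_left hp hq a
  rw [betaMeasure, integral_withDensity_eq_integral_toReal_smul (hm _) (hfin _)] at h1 ⊢
  have hb0 := beta_pos hp hq
  have hba := beta_pos hpa hq
  have hpt : ∀ x, (betaPDF p q x).toReal • x ^ a =
      (∏ i ∈ Finset.range a, ((p + i) / (p + q + i))) *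
        ((betaPDF (p + a) q x).toReal • (1 : ℝ)) := by
    intro x
    rw [betaPDF_eq, betaPDF_eq]
    split_ifs with hx
    · have hx1 : 0 < 1 - x := by linarith [hx.2]
      have hx0 := hx.1
      rw [ENNReal.toReal_ofReal (by positivity), ENNReal.toReal_ofReal (by positivity), hb]
      have hpow : x ^ (p + a - 1) = x ^ (p - 1) * x ^ a := by
        rw [← Real.rpow_natCast, ← Real.rpow_add hx0]
        ring_nf
      have hprod : 0 < ∏ i ∈ Finset.range a, ((p + i) / (p + q + i)) :=
        Finset.prod_pos fun i _ => by positivity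
      rw [hpow]
      simp only [smul_eq_mul]
      field_simp
    · simp
  simp only [hpt]
  rw [integral_const_mul, h1, mul_one]

/-! ### The number of blocks tends to infinity -/

section Growth

variable {Ω : Type*} [MeasurableSpace Ω] {P : Measure Ω} {k : ℕ} {g : (n : ℕ) → Ω → Fin (k * n + 1)}

/-- The first gap is chosen infinitely often: by the second Borel–Cantelli lemma, as the harmonic
series diverges. -/
theorem ae_frequently_gap_eq_zero [IsProbabilityMeasure P] (hk : 0 < k)
    (hgm : ∀ n, Measurable (g n))
    (hg : ∀ n, HasLaw (g n) (uniformOn (Set.univ : Set (Fin (k * n + 1)))) P)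
    (hindep : iIndepFun g P) : ∀ᵐ ω ∂P, ∃ᶠ n in atTop, g n ω = 0 := by
  have hset : ∀ n, MeasurableSet (g n ⁻¹' {0}) := fun n => hgm n (measurableSet_singleton 0)
  have hind : iIndepSet (fun n => g n ⁻¹' {0}) P := by
    rw [iIndepSet_iff_meas_biInter hset]
    intro s
    exact hindep.meas_biInter fun i _ => ⟨{0}, measurableSet_singleton 0, rfl⟩
  have hsum : ∑' n, P (g n ⁻¹' {0}) = ⊤ := by
    by_contra hne
    have h1 := ENNReal.summable_toReal hne
    have h2 : Summable fun n : ℕ => (k : ℝ) * (P (g n ⁻¹' {0})).toReal := h1.mul_left _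
    refine mt (summable_nat_add_iff 1).1 Real.not_summable_one_div_natCast
      (h2.of_nonneg_of_le (fun n => by positivity) fun n => ?_)
    have hk1 : (1 : ℝ) ≤ k := by exact_mod_cast hk
    have e : (P (g n ⁻¹' {0})).toReal = ((k : ℝ) * n + 1)⁻¹ := by
      rw [measure_gap_eq hgm hg n 0, ENNReal.toReal_inv]
      norm_cast
    -- `1 / (n + 1) ≤ k / (k * n + 1)`
    rw [e, ← div_eq_mul_inv, div_le_div_iff₀ (by positivity) (by positivity)]
    push_cast
    nlinarith
  have h := measure_limsup_eq_one hset hind hsum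
  have h' : P (limsup (fun n => g n ⁻¹' {0}) atTop)ᶜ = 0 := by
    rw [prob_compl_eq_zero_iff (MeasurableSet.measurableSet_limsup hset), h]
  filter_upwards [compl_mem_ae_iff.2 h'] with ω hω
  rw [compl_compl, limsup_eq_iInf_iSup_of_nat] at hω
  rw [frequently_atTop]
  intro N
  simp only [Set.iInf_eq_iInter, Set.iSup_eq_iUnion, Set.mem_iInter, Set.mem_iUnion] at hω
  obtain ⟨n, hn, h⟩ := hω N
  exact ⟨n, hn, h⟩

/-- The number of blocks tends to infinity if the first gap is chosen infinitely often. -/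
theorem tendsto_card_blocks (hk : 0 < k) {h : (n : ℕ) → Fin (k * n + 1)}
    (hfreq : ∃ᶠ n in atTop, h n = 0) :
    Tendsto (fun n => (blocks (stirlingGrowth k h n)).card) atTop atTop := by
  have hstep : ∀ n, (blocks (stirlingGrowth k h (n + 1))).card =
      (blocks (stirlingGrowth k h n)).card +
        if growthIndex (stirlingGrowth k h n) (h n) = (blocks (stirlingGrowth k h n)).card
        then 1 else 0 := by
    intro n
    have hl := stirlingGrowth_mem k h n
    refine card_blocks_insertRun hk hl ?_
    rw [length_of_mem_stirlingPerms hl]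
    exact Nat.lt_succ_iff.1 (h n).2
  have hmono : Monotone fun n => (blocks (stirlingGrowth k h n)).card :=
    monotone_nat_of_le_succ fun n => by rw [hstep]; exact Nat.le_add_right _ _
  refine tendsto_atTop_atTop_of_monotone hmono fun b => ?_
  induction b with
  | zero => exact ⟨0, Nat.zero_le _⟩
  | succ b ih =>
    obtain ⟨N, hN⟩ := ih
    obtain ⟨n, hn, h0⟩ := frequently_atTop.1 hfreq N
    refine ⟨n + 1, ?_⟩
    rw [hstep, h0, Fin.val_zero, if_pos (growthIndex_zero _)]
    exact Nat.succ_le_succ (hN.trans (hmono hn))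

end Growth

/-! ### Scheffé convergence and stick breaking -/

/-- Scheffé's lemma for series: pointwise convergence of nonnegative sequences with sum `1` to a
sequence with sum `1` implies convergence in `ℓ¹`. -/
theorem tendsto_tsum_enorm_sub_of_hasSum {x : ℕ → ℕ → ℝ} {p : ℕ → ℝ} (hx0 : ∀ n m, 0 ≤ x n m)
    (hp0 : ∀ m, 0 ≤ p m) (hx : ∀ᶠ n in atTop, HasSum (x n) 1) (hp : HasSum p 1)
    (hlim : ∀ m, Tendsto (fun n => x n m) atTop (𝓝 (p m))) :
    Tendsto (fun n => ∑' m, ‖x n m - p m‖ₑ) atTop (𝓝 0) := by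
  have h1 : Tendsto (fun n => ∑' m, max (p m - x n m) 0) atTop (𝓝 (∑' _ : ℕ, (0 : ℝ))) := by
    refine tendsto_tsum_of_dominated_convergence hp.summable (fun m => ?_)
      (Eventually.of_forall fun n m => ?_)
    · have := ((tendsto_const_nhds (x := p m)).sub (hlim m)).max (tendsto_const_nhds (x := (0 : ℝ)))
      simpa using this
    · rw [Real.norm_of_nonneg (le_max_right _ _)]
      exact max_le (by linarith [hx0 n m]) (hp0 m)
  -- `|x - p| = (x - p) + 2 (p - x)⁺`, and the first term has sum `0`
  have h2 : ∀ᶠ n in atTop, ∑' m, ‖x n m - p m‖ₑ =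
      ENNReal.ofReal (2 * ∑' m, max (p m - x n m) 0) := by
    filter_upwards [hx] with n hn
    have hs : Summable fun m => max (p m - x n m) 0 :=
      hp.summable.of_nonneg_of_le (fun m => le_max_right _ _) fun m =>
        max_le (by linarith [hx0 n m]) (hp0 m)
    have habs : ∀ m, |x n m - p m| = (x n m - p m) + 2 * max (p m - x n m) 0 := by
      intro m
      rcases le_total (p m) (x n m) with h | h
      · rw [abs_of_nonneg (by linarith), max_eq_right (by linarith)]; ring
      · rw [abs_of_nonpos (by linarith), max_eq_left (by linarith)]; ring
    have h3 : HasSum (fun m => |x n m - p m|) (2 * ∑' m, max (p m - x n m) 0) := by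
      simp only [habs]
      simpa using (hn.sub hp).add (hs.hasSum.mul_left 2)
    rw [← h3.tsum_eq, ENNReal.ofReal_tsum_of_nonneg (fun m => abs_nonneg _) h3.summable]
    simp only [Real.enorm_eq_ofReal_abs]
  rw [tendsto_congr' h2, ← ENNReal.ofReal_zero]
  refine ENNReal.tendsto_ofReal ?_
  simpa using h1.const_mul 2

theorem sum_mul_prod_one_sub (b : ℕ → ℝ) (M : ℕ) :
    ∑ m ∈ Finset.range M, b m * ∏ i ∈ Finset.range m, (1 - b i) =
      1 - ∏ i ∈ Finset.range M, (1 - b i) := by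
  induction M with
  | zero => simp
  | succ M ih => rw [Finset.sum_range_succ, ih, Finset.prod_range_succ]; ring

/-! ### Limits along a fixed sequence of words -/

/-- Rising ratios with growing parameters behave like powers. -/
theorem tendsto_risingRatio {x y : ℕ → ℝ} {β k : ℝ} (hy : Tendsto y atTop atTop)
    (h : Tendsto (fun n => x n / y n) atTop (𝓝 β)) (a : ℕ) :
    Tendsto (fun n => risingRatio k (x n) (y n) a) atTop (𝓝 (β ^ a)) := by
  have hpow : β ^ a = ∏ _i ∈ Finset.range a, β := by simp
  rw [hpow]
  refine tendsto_finsetProd _ fun i _ => ?_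
  have hr : Tendsto (fun n => k * i / (y n + k * i)) atTop (𝓝 0) :=
    tendsto_const_nhds.div_atTop (tendsto_atTop_add_const_right _ _ hy)
  have h1 : Tendsto (fun n => x n / y n * (1 - k * i / (y n + k * i)) + k * i / (y n + k * i))
      atTop (𝓝 (β * (1 - 0) + 0)) := (h.mul (tendsto_const_nhds.sub hr)).add hr
  rw [sub_zero, mul_one, add_zero] at h1
  refine h1.congr' ?_
  filter_upwards [hy.eventually_gt_atTop 0,
    (tendsto_atTop_add_const_right _ (k * i) hy).eventually_gt_atTop 0] with n h0 h0'
  field_simp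
  ring

section Words

variable {k : ℕ} {W : ℕ → List ℕ}

theorem card_blocks_le_tailSize {n : ℕ} {l : List ℕ} (hl : l ∈ stirlingPerms k n) (m : ℕ) :
    ((blocks l).card : ℝ) - m ≤ tailSize k n (blockSize l) m := by
  rcases le_or_gt (blocks l).card m with h | h
  · have h1 := tailSize_nonneg hl m
    have : ((blocks l).card : ℝ) ≤ m := by exact_mod_cast h
    linarith
  · have h1 := sum_blockSize hl le_rfl
    rw [← Finset.sum_range_add_sum_Ico _ h.le] at h1
    have h2 : ∑ i ∈ Finset.Ico m (blocks l).card, 1 ≤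
        ∑ i ∈ Finset.Ico m (blocks l).card, blockSize l i :=
      Finset.sum_le_sum fun i hi => blockSize_pos (Finset.mem_Ico.1 hi).2
    rw [Finset.sum_const, Nat.card_Ico, smul_eq_mul, mul_one] at h2
    have h3 : (((∑ i ∈ Finset.range m, blockSize l i) + (blocks l).card : ℕ) : ℝ) ≤
        ((k * n + m : ℕ) : ℝ) := by
      exact_mod_cast (by omega)
    push_cast at h3
    rw [tailSize]
    linarith

theorem tendsto_tailSize (hW : ∀ n, W n ∈ stirlingPerms k n)
    (hB : Tendsto (fun n => (blocks (W n)).card) atTop atTop) (m : ℕ) :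
    Tendsto (fun n => tailSize k n (blockSize (W n)) m) atTop atTop :=
  tendsto_atTop_mono (fun n => card_blocks_le_tailSize (hW n) m)
    (tendsto_atTop_add_const_right _ (-(m : ℝ)) (tendsto_natCast_atTop_atTop.comp hB))

theorem eventually_blockSize_ne_zero (hB : Tendsto (fun n => (blocks (W n)).card) atTop atTop)
    (m : ℕ) : ∀ᶠ n in atTop, blockSize (W n) m ≠ 0 := by
  filter_upwards [hB.eventually_gt_atTop m] with n hn
  exact (blockSize_pos hn).ne'

theorem tendsto_tailSize_add (hW : ∀ n, W n ∈ stirlingPerms k n)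
    (hB : Tendsto (fun n => (blocks (W n)).card) atTop atTop) (m : ℕ) :
    Tendsto (fun n => tailSize k n (blockSize (W n)) m + m + 1) atTop atTop :=
  tendsto_atTop_add_const_right _ _ (tendsto_atTop_add_const_right _ _ (tendsto_tailSize hW hB m))

theorem tendsto_urn_quotient (hB : Tendsto (fun n => (blocks (W n)).card) atTop atTop)
    {m : ℕ} {β : ℝ}
    (h : Tendsto (fun n => urnFactor k n (blockSize (W n)) 1 m) atTop (𝓝 β)) :
    Tendsto (fun n => ((blockSize (W n) m : ℝ) - 1) / (tailSize k n (blockSize (W n)) m + m + 1))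
      atTop (𝓝 β) := by
  refine h.congr' ?_
  filter_upwards [eventually_blockSize_ne_zero hB m] with n hn
  simp [urnFactor, hn, risingRatio]

/-- The contribution of a block with exponent `a` converges to the `a`-th power of the limit of its
contribution with exponent `1`. -/
theorem tendsto_urnFactor (hW : ∀ n, W n ∈ stirlingPerms k n)
    (hB : Tendsto (fun n => (blocks (W n)).card) atTop atTop) {m : ℕ} {β : ℝ}
    (h : Tendsto (fun n => urnFactor k n (blockSize (W n)) 1 m) atTop (𝓝 β)) (a : ℕ) :
    Tendsto (fun n => urnFactor k n (blockSize (W n)) a m) atTop (𝓝 (β ^ a)) := by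
  refine (tendsto_risingRatio (k := k) (tendsto_tailSize_add hW hB m)
    (tendsto_urn_quotient hB h) a).congr' ?_
  filter_upwards [eventually_blockSize_ne_zero hB m] with n hn
  rw [urnFactor, if_neg hn]

/-- The block takes asymptotically the fraction `β` of the letters outside the earlier blocks. -/
theorem tendsto_blockSize_div_tailSize (hW : ∀ n, W n ∈ stirlingPerms k n)
    (hB : Tendsto (fun n => (blocks (W n)).card) atTop atTop) {m : ℕ} {β : ℝ}
    (h : Tendsto (fun n => urnFactor k n (blockSize (W n)) 1 m) atTop (𝓝 β)) :
    Tendsto (fun n => (blockSize (W n) m : ℝ) / tailSize k n (blockSize (W n)) m)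
      atTop (𝓝 β) := by
  have hs := tendsto_tailSize hW hB m
  have h1 : Tendsto (fun n => ((m : ℝ) + 1) / tailSize k n (blockSize (W n)) m) atTop (𝓝 0) :=
    tendsto_const_nhds.div_atTop hs
  have h2 : Tendsto (fun n => (1 : ℝ) / tailSize k n (blockSize (W n)) m) atTop (𝓝 0) :=
    tendsto_const_nhds.div_atTop hs
  have h3 := ((tendsto_urn_quotient hB h).mul (h1.const_add 1)).add h2
  rw [add_zero, add_zero, mul_one] at h3
  refine h3.congr' ?_
  filter_upwards [hs.eventually_gt_atTop 0] with n hn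
  have : (0 : ℝ) ≤ m := by positivity
  have hne : tailSize k n (blockSize (W n)) m + m + 1 ≠ 0 := by positivity
  field_simp
  ring

theorem tendsto_tailSize_div (hk : 0 < k) (hW : ∀ n, W n ∈ stirlingPerms k n)
    (hB : Tendsto (fun n => (blocks (W n)).card) atTop atTop) {b : ℕ → ℝ}
    (h : ∀ m, Tendsto (fun n => urnFactor k n (blockSize (W n)) 1 m) atTop (𝓝 (b m))) (m : ℕ) :
    Tendsto (fun n => tailSize k n (blockSize (W n)) m / ((k : ℝ) * n)) atTop
      (𝓝 (∏ i ∈ Finset.range m, (1 - b i))) := by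
  induction m with
  | zero =>
    rw [Finset.prod_range_zero]
    refine tendsto_const_nhds.congr' ?_
    filter_upwards [eventually_gt_atTop 0] with n hn
    rw [tailSize, Finset.sum_range_zero, sub_zero, div_self]
    positivity
  | succ m ih =>
    rw [Finset.prod_range_succ]
    refine (ih.mul ((tendsto_blockSize_div_tailSize hW hB (h m)).const_sub 1)).congr' ?_
    filter_upwards [(tendsto_tailSize hW hB m).eventually_gt_atTop 0,
      eventually_gt_atTop 0] with n hn hn0
    rw [tailSize_succ]
    field_simp

theorem tendsto_blockSize_div (hk : 0 < k) (hW : ∀ n, W n ∈ stirlingPerms k n)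
    (hB : Tendsto (fun n => (blocks (W n)).card) atTop atTop) {b : ℕ → ℝ}
    (h : ∀ m, Tendsto (fun n => urnFactor k n (blockSize (W n)) 1 m) atTop (𝓝 (b m))) (m : ℕ) :
    Tendsto (fun n => (blockSize (W n) m : ℝ) / ((k : ℝ) * n)) atTop
      (𝓝 (b m * ∏ i ∈ Finset.range m, (1 - b i))) := by
  refine ((tendsto_blockSize_div_tailSize hW hB (h m)).mul
    (tendsto_tailSize_div hk hW hB h m)).congr' ?_
  filter_upwards [(tendsto_tailSize hW hB m).eventually_gt_atTop 0] with n hn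
  field_simp

theorem hasSum_blockSize_div {n : ℕ} {l : List ℕ} (hl : l ∈ stirlingPerms k n) (hk : 0 < k)
    (hn : 0 < n) : HasSum (fun m => (blockSize l m : ℝ) / ((k : ℝ) * n)) 1 := by
  have h : HasSum (fun m => (blockSize l m : ℝ) / ((k : ℝ) * n))
      (∑ m ∈ Finset.range (blocks l).card, (blockSize l m : ℝ) / ((k : ℝ) * n)) := by
    refine hasSum_sum_of_ne_finset_zero fun m hm => ?_
    rw [blockSize_eq_zero (by simpa using hm)]
    simp
  rwa [← Finset.sum_div, ← Nat.cast_sum, sum_blockSize hl le_rfl, Nat.cast_mul, div_self] at h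
  positivity

end Words

/-! ### The limiting fractions and their joint law -/

section Growth

variable {Ω : Type*} [MeasurableSpace Ω] {P : Measure Ω} {k : ℕ} {g : (n : ℕ) → Ω → Fin (k * n + 1)}

theorem urnProd_single (k m n : ℕ) (l : List ℕ) :
    urnProd k (Pi.single m 1) (m + 1) n l = urnFactor k n (blockSize l) 1 m := by
  rw [urnProd, Finset.prod_range_succ, Pi.single_eq_same, Finset.prod_eq_one, one_mul]
  intro i hi
  rw [Pi.single_eq_of_ne (Finset.mem_range.1 hi).ne]
  simp [urnFactor, risingRatio]

theorem martingale_urnProd [IsProbabilityMeasure P] (hk : 0 < k) (hgm : ∀ n, Measurable (g n))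
    (hg : ∀ n, HasLaw (g n) (uniformOn (Set.univ : Set (Fin (k * n + 1)))) P)
    (hindep : iIndepFun g P) (a : ℕ → ℕ) (M : ℕ) :
    Martingale (fun n ω => urnProd k a M n (stirlingGrowth k (fun i => g i ω) n))
      (gapFiltration hgm) P :=
  martingale_of_sum_insertRun hgm hg hindep (fun _ _ hl => urnProd_mem_Icc hk hl a M)
    fun _ _ hl => sum_urnProd_insertRun hk hl a M

/-- The limiting fraction `β` of the urn that decides between block `m` and the later blocks. The
upper limit makes it measurable; it is a limit, and the projection to the unit interval changes
nothing, outside a null set. -/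
noncomputable def urnLimit (g : (n : ℕ) → Ω → Fin (k * n + 1)) (m : ℕ) (ω : Ω) : unitInterval :=
  Set.projIcc 0 1 zero_le_one
    (limsup (fun n => urnFactor k n (blockSize (stirlingGrowth k (fun i => g i ω) n)) 1 m) atTop)

theorem measurable_urnLimit (hgm : ∀ n, Measurable (g n)) (m : ℕ) : Measurable (urnLimit g m) :=
  continuous_projIcc.measurable.comp (Measurable.limsup fun n =>
    (measurable_comp_stirlingGrowth hgm n fun l => urnFactor k n (blockSize l) 1 m).mono
      ((gapFiltration hgm).le n) le_rfl)

theorem ae_tendsto_urnLimit [IsProbabilityMeasure P] (hk : 0 < k) (hgm : ∀ n, Measurable (g n))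
    (hg : ∀ n, HasLaw (g n) (uniformOn (Set.univ : Set (Fin (k * n + 1)))) P)
    (hindep : iIndepFun g P) :
    ∀ᵐ ω ∂P, ∀ m, Tendsto
      (fun n => urnFactor k n (blockSize (stirlingGrowth k (fun i => g i ω) n)) 1 m) atTop
      (𝓝 (urnLimit g m ω : ℝ)) := by
  rw [ae_all_iff]
  intro m
  have hbdd : ∀ n, eLpNorm (fun ω => urnProd k (Pi.single m 1) (m + 1) n
      (stirlingGrowth k (fun i => g i ω) n)) 1 P ≤ (1 : NNReal) := by
    intro n
    refine (eLpNorm_le_of_ae_bound (C := 1) (ae_of_all _ fun ω => ?_)).trans (by simp)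
    have := urnProd_mem_Icc hk (stirlingGrowth_mem k (fun i => g i ω) n) (Pi.single m 1) (m + 1)
    rw [Real.norm_eq_abs, abs_of_nonneg this.1]
    exact this.2
  filter_upwards [(martingale_urnProd hk hgm hg hindep (Pi.single m 1)
    (m + 1)).submartingale.exists_ae_tendsto_of_bdd hbdd] with ω hω
  obtain ⟨c, hc⟩ := hω
  simp only [urnProd_single] at hc
  have hmem := isClosed_Icc.mem_of_tendsto hc (Eventually.of_forall fun n =>
    urnFactor_mem_Icc hk (stirlingGrowth_mem k (fun i => g i ω) n) 1 m)
  rw [urnLimit, hc.limsup_eq, Set.projIcc_of_mem _ hmem]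
  exact hc

/-- The mixed moments of the limiting fractions are those of the urn functional at time `0`. -/
theorem integral_prod_urnLimit [IsProbabilityMeasure P] (hk : 0 < k) (hgm : ∀ n, Measurable (g n))
    (hg : ∀ n, HasLaw (g n) (uniformOn (Set.univ : Set (Fin (k * n + 1)))) P)
    (hindep : iIndepFun g P) (a : ℕ → ℕ) (M : ℕ) :
    ∫ ω, ∏ i ∈ Finset.range M, (urnLimit g i ω : ℝ) ^ a i ∂P =
      ∏ i ∈ Finset.range M, risingRatio k (k - 1) (k + i + 1) (a i) := by
  have hm := martingale_urnProd hk hgm hg hindep a M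
  have hconst : ∀ n, ∫ ω, urnProd k a M n (stirlingGrowth k (fun i => g i ω) n) ∂P =
      ∏ i ∈ Finset.range M, risingRatio k (k - 1) (k + i + 1) (a i) := by
    intro n
    have h := hm.setIntegral_eq (Nat.zero_le n) MeasurableSet.univ
    simp only [setIntegral_univ] at h
    rw [← h]
    have h0 : ∀ i, blockSize [] i = 0 := fun i => by simp [blockSize, blocks]
    simp [urnProd, stirlingGrowth, urnFactor, h0]
  have hlim : Tendsto (fun n => ∫ ω, urnProd k a M n (stirlingGrowth k (fun i => g i ω) n) ∂P) atTop
      (𝓝 (∫ ω, ∏ i ∈ Finset.range M, (urnLimit g i ω : ℝ) ^ a i ∂P)) := by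
    refine tendsto_integral_of_dominated_convergence (fun _ => 1)
      (fun n => (hm.integrable n).aestronglyMeasurable) (integrable_const _)
      (fun n => ae_of_all _ fun ω => ?_) ?_
    · have := urnProd_mem_Icc hk (stirlingGrowth_mem k (fun i => g i ω) n) a M
      rw [Real.norm_eq_abs, abs_of_nonneg this.1]
      exact this.2
    · filter_upwards [ae_tendsto_urnLimit hk hgm hg hindep,
        ae_frequently_gap_eq_zero hk hgm hg hindep] with ω h1 h2
      exact tendsto_finsetProd _ fun i _ => tendsto_urnFactor (stirlingGrowth_mem k _)
        (tendsto_card_blocks hk h2) (h1 i) (a i)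
  simp only [hconst] at hlim
  exact (tendsto_nhds_unique hlim tendsto_const_nhds)

/-- The beta distribution, as a measure on the unit interval. The joint law of
the limiting fractions is identified on this compact space, where mixed moments determine laws. -/
noncomputable def betaUnit (p q : ℝ) : Measure unitInterval :=
  (betaMeasure p q).map (Set.projIcc 0 1 zero_le_one)

theorem isProbabilityMeasure_betaUnit {p q : ℝ} (hp : 0 < p) (hq : 0 < q) :
    IsProbabilityMeasure (betaUnit p q) :=
  have := isProbabilityMeasureBeta hp hq
  Measure.isProbabilityMeasure_map continuous_projIcc.measurable.aemeasurable

theorem map_val_betaUnit (p q : ℝ) : (betaUnit p q).map Subtype.val = betaMeasure p q := by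
  rw [betaUnit, Measure.map_map measurable_subtype_coe continuous_projIcc.measurable]
  conv_rhs => rw [← Measure.map_id (μ := betaMeasure p q)]
  refine Measure.map_congr ?_
  filter_upwards [ae_betaMeasure_mem_Ioo p q] with x hx
  simp [Set.projIcc_of_mem _ (Set.Ioo_subset_Icc_self hx)]

theorem integral_pow_betaUnit {p q : ℝ} (hp : 0 < p) (hq : 0 < q) (a : ℕ) :
    ∫ x, (x : ℝ) ^ a ∂betaUnit p q = ∏ i ∈ Finset.range a, ((p + i) / (p + q + i)) := by
  rw [← integral_pow_betaMeasure hp hq, ← map_val_betaUnit p q,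
    integral_map measurable_subtype_coe.aemeasurable (by fun_prop)]

theorem risingRatio_eq_prod {k : ℝ} (hk : 0 < k) (m a : ℕ) :
    risingRatio k (k - 1) (k + m + 1) a =
      ∏ i ∈ Finset.range a, (((k - 1) / k + i) / ((k - 1) / k + (m + 2) / k + i)) := by
  refine Finset.prod_congr rfl fun i _ => ?_
  have h : k + m + 1 + k * i ≠ 0 := by positivity
  have h' : (k - 1) / k + (m + 2) / k + i = (k + m + 1 + k * i) / k := by field_simp; ring
  rw [h', div_div_eq_mul_div]
  congr 1
  field_simp

/-- The limiting fractions are independent and beta distributed. -/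
theorem map_urnLimit [IsProbabilityMeasure P] (hk : 2 ≤ k) (hgm : ∀ n, Measurable (g n))
    (hg : ∀ n, HasLaw (g n) (uniformOn (Set.univ : Set (Fin (k * n + 1)))) P)
    (hindep : iIndepFun g P) :
    P.map (fun ω m => urnLimit g m ω) = Measure.infinitePi fun m : ℕ =>
      betaUnit (((k : ℝ) - 1) / k) (((m : ℝ) + 2) / k) := by
  have hk0 : (0 : ℝ) < k := by positivity
  have hk1 : (0 : ℝ) < k - 1 := by
    have : (2 : ℝ) ≤ k := by exact_mod_cast hk
    linarith
  have hp : 0 < ((k : ℝ) - 1) / k := by positivity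
  have hq : ∀ m : ℕ, 0 < ((m : ℝ) + 2) / k := fun m => by positivity
  have hprob : ∀ m : ℕ, IsProbabilityMeasure (betaUnit (((k : ℝ) - 1) / k) (((m : ℝ) + 2) / k)) :=
    fun m => isProbabilityMeasure_betaUnit hp (hq m)
  have hmeas : Measurable fun ω m => urnLimit g m ω :=
    measurable_pi_lambda _ fun m => measurable_urnLimit hgm m
  have := Measure.isProbabilityMeasure_map (μ := P) hmeas.aemeasurable
  refine Measure.ext_of_mixed_moments fun a M => ?_
  rw [integral_map hmeas.aemeasurable (by
      exact (Finset.measurable_prod _ fun i _ => by fun_prop).aestronglyMeasurable),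
    integral_prod_urnLimit (by omega) hgm hg hindep]
  have hpi : iIndepFun (fun (i : Fin M) (x : ℕ → unitInterval) => x i)
      (Measure.infinitePi fun m : ℕ => betaUnit (((k : ℝ) - 1) / k) (((m : ℝ) + 2) / k)) :=
    (iIndepFun_infinitePi (X := fun _ x => x) fun _ => measurable_id).precomp Fin.val_injective
  have h := iIndepFun.integral_fun_prod_comp
    (X := fun (i : Fin M) (x : ℕ → unitInterval) => x i)
    (f := fun (i : Fin M) (x : unitInterval) => (x : ℝ) ^ a i) hpi
    (fun i => (measurable_pi_apply _).aemeasurable) (fun i => by fun_prop)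
  simp only [Finset.prod_range]
  rw [h]
  refine Finset.prod_congr rfl fun i _ => ?_
  rw [risingRatio_eq_prod hk0, ← integral_pow_betaUnit hp (hq i),
    ← Measure.infinitePi_map_eval (fun m : ℕ => betaUnit (((k : ℝ) - 1) / k) (((m : ℝ) + 2) / k)) i,
    integral_map (measurable_pi_apply _).aemeasurable (by fun_prop)]

theorem isProbabilityMeasure_betaUnit_params (hk : 2 ≤ k) (m : ℕ) :
    IsProbabilityMeasure (betaUnit (((k : ℝ) - 1) / k) (((m : ℝ) + 2) / k)) := by
  have : (2 : ℝ) ≤ k := by exact_mod_cast hk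
  exact isProbabilityMeasure_betaUnit (div_pos (by linarith) (by linarith)) (by positivity)

theorem hasLaw_urnLimit [IsProbabilityMeasure P] (hk : 2 ≤ k) (hgm : ∀ n, Measurable (g n))
    (hg : ∀ n, HasLaw (g n) (uniformOn (Set.univ : Set (Fin (k * n + 1)))) P)
    (hindep : iIndepFun g P) (m : ℕ) :
    HasLaw (urnLimit g m) (betaUnit (((k : ℝ) - 1) / k) (((m : ℝ) + 2) / k)) P where
  aemeasurable := (measurable_urnLimit hgm m).aemeasurable
  map_eq := by
    have := isProbabilityMeasure_betaUnit_params hk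
    rw [← Measure.infinitePi_map_eval
      (fun m : ℕ => betaUnit (((k : ℝ) - 1) / k) (((m : ℝ) + 2) / k)) m,
      ← map_urnLimit hk hgm hg hindep, Measure.map_map (measurable_pi_apply m)
        (measurable_pi_lambda _ fun m => measurable_urnLimit hgm m)]
    rfl

theorem iIndepFun_urnLimit [IsProbabilityMeasure P] (hk : 2 ≤ k) (hgm : ∀ n, Measurable (g n))
    (hg : ∀ n, HasLaw (g n) (uniformOn (Set.univ : Set (Fin (k * n + 1)))) P)
    (hindep : iIndepFun g P) : iIndepFun (urnLimit g) P := by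
  have := isProbabilityMeasure_betaUnit_params hk
  have hmeas : Measurable fun ω m => urnLimit g m ω :=
    measurable_pi_lambda _ fun m => measurable_urnLimit hgm m
  exact (iIndepFun_iff_hasLaw_Pi_infinitePi (hasLaw_urnLimit hk hgm hg hindep)
    hmeas.aemeasurable).2 ⟨hmeas.aemeasurable, map_urnLimit hk hgm hg hindep⟩

/-- The fraction of the letters outside the first `M` blocks tends to `0`: its mean is at most
`2 / (M + 2)`. -/
theorem ae_tendsto_prod_one_sub_urnLimit [IsProbabilityMeasure P] (hk : 2 ≤ k)
    (hgm : ∀ n, Measurable (g n))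
    (hg : ∀ n, HasLaw (g n) (uniformOn (Set.univ : Set (Fin (k * n + 1)))) P)
    (hindep : iIndepFun g P) :
    ∀ᵐ ω ∂P, Tendsto (fun M => ∏ i ∈ Finset.range M, (1 - (urnLimit g i ω : ℝ))) atTop
      (𝓝 0) := by
  have hk2 : (2 : ℝ) ≤ k := by exact_mod_cast hk
  have hmeas := measurable_urnLimit hgm
  have hbdd : ∀ M ω, ∏ i ∈ Finset.range M, (1 - (urnLimit g i ω : ℝ)) ∈ Set.Icc 0 1 :=
    fun M ω => ⟨Finset.prod_nonneg fun i _ => by linarith [(urnLimit g i ω).2.2],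
      Finset.prod_le_one (fun i _ => by linarith [(urnLimit g i ω).2.2])
        fun i _ => by linarith [(urnLimit g i ω).2.1]⟩
  have hint : ∀ M,
      Integrable (fun ω => ∏ i ∈ Finset.range M, (1 - (urnLimit g i ω : ℝ))) P := by
    intro M
    refine Integrable.of_bound (Finset.measurable_prod _ fun i _ =>
      measurable_const.sub (hmeas i).subtype_val).aestronglyMeasurable 1 (ae_of_all _ fun ω => ?_)
    rw [Real.norm_eq_abs, abs_of_nonneg (hbdd M ω).1]
    exact (hbdd M ω).2
  have hmean : ∀ i, ∫ ω, (1 - (urnLimit g i ω : ℝ)) ∂P = ((i : ℝ) + 2) / (k + i + 1) := by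
    intro i
    have h1 := integral_prod_urnLimit (by omega) hgm hg hindep (Pi.single i 1) (i + 1)
    simp only [Finset.prod_range_succ, Pi.single_eq_same] at h1
    have h2 : ∀ j ∈ Finset.range i, (Pi.single i 1 : ℕ → ℕ) j = 0 := fun j hj =>
      Pi.single_eq_of_ne (Finset.mem_range.1 hj).ne _
    rw [Finset.prod_eq_one fun j hj => by rw [h2 j hj]; simp [risingRatio]] at h1
    have h3 : ∀ ω, ∏ j ∈ Finset.range i, (urnLimit g j ω : ℝ) ^ (Pi.single i 1 : ℕ → ℕ) j = 1 :=
      fun ω => Finset.prod_eq_one fun j hj => by rw [h2 j hj, pow_zero]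
    simp only [h3, one_mul, pow_one] at h1
    have hi : Integrable (fun ω => (urnLimit g i ω : ℝ)) P := by
      refine Integrable.of_bound (hmeas i).subtype_val.aestronglyMeasurable 1
        (ae_of_all _ fun ω => ?_)
      rw [Real.norm_eq_abs, abs_of_nonneg (urnLimit g i ω).2.1]
      exact (urnLimit g i ω).2.2
    rw [integral_sub (integrable_const _) hi, h1]
    simp only [risingRatio, integral_const, probReal_univ, smul_eq_mul, mul_one,
      Finset.prod_range_one, Nat.cast_zero, mul_zero, add_zero]
    have : (k : ℝ) + i + 1 ≠ 0 := by positivity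
    field_simp
    ring
  have hprod : ∀ M, ∫ ω, ∏ i ∈ Finset.range M, (1 - (urnLimit g i ω : ℝ)) ∂P =
      ∏ i ∈ Finset.range M, (((i : ℝ) + 2) / (k + i + 1)) := by
    intro M
    have h := iIndepFun.integral_fun_prod_comp (X := fun (i : Fin M) => urnLimit g i)
      (f := fun (_ : Fin M) (x : unitInterval) => 1 - (x : ℝ))
      ((iIndepFun_urnLimit hk hgm hg hindep).precomp Fin.val_injective)
      (fun i => (hmeas i).aemeasurable) (fun i => by fun_prop)
    simp only [Finset.prod_range]
    rw [h]
    exact Finset.prod_congr rfl fun i _ => hmean i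
  have hle : ∀ M : ℕ, ∏ i ∈ Finset.range M, (((i : ℝ) + 2) / (k + i + 1)) ≤ 2 / (M + 2) := by
    intro M
    induction M with
    | zero => simp
    | succ M ih =>
      rw [Finset.prod_range_succ]
      calc _ ≤ 2 / ((M : ℝ) + 2) * (((M : ℝ) + 2) / (M + 3)) := by
            gcongr ?_ * (_ / ?_)
            linarith
        _ = _ := by push_cast; field_simp; ring
  refine tendsto_of_integral_tendsto_of_antitone (F := fun _ => (0 : ℝ)) hint
    (integrable_const _) ?_ (ae_of_all _ fun ω => ?_) (ae_of_all _ fun ω M => (hbdd M ω).1)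
  · rw [integral_zero]
    refine squeeze_zero (fun M => integral_nonneg fun ω => (hbdd M ω).1)
      (fun M => (hprod M).trans_le (hle M)) ?_
    exact tendsto_const_nhds.div_atTop
      (tendsto_atTop_add_const_right _ _ tendsto_natCast_atTop_atTop)
  · refine antitone_nat_of_succ_le fun M => ?_
    rw [Finset.prod_range_succ]
    exact mul_le_of_le_one_right (hbdd M ω).1 (by linarith [(urnLimit g M ω).2.1])

end Growth

/-- The limit theorem for gaps that are measurable, not only almost everywhere. -/
theorem exists_beta_tendsto_of_measurable (k : ℕ) (hk : 2 ≤ k) {Ω : Type*} [MeasurableSpace Ω]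
    (P : Measure Ω) [IsProbabilityMeasure P] (g : (n : ℕ) → Ω → Fin (k * n + 1))
    (hgm : ∀ n, Measurable (g n))
    (hg : ∀ n, HasLaw (g n) (uniformOn (Set.univ : Set (Fin (k * n + 1)))) P)
    (hindep : iIndepFun g P) :
    ∃ β : ℕ → Ω → ℝ,
      (∀ m, Measurable (β m)) ∧
      (∀ m, HasLaw (β m) (betaMeasure (((k : ℝ) - 1) / k) (((m : ℝ) + 2) / k)) P) ∧
      iIndepFun β P ∧
      ∀ᵐ ω ∂P,
        Tendsto
          (fun (n : ℕ) (m : ℕ) =>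
            (blockSize (stirlingGrowth k (fun i => g i ω) n) m : ℝ) / ((k : ℝ) * n))
          atTop (𝓝 (fun m => β m ω * ∏ i ∈ Finset.range m, (1 - β i ω))) ∧
        Tendsto
          (fun n : ℕ => ∑' m : ℕ,
            ‖(blockSize (stirlingGrowth k (fun i => g i ω) n) m : ℝ) / ((k : ℝ) * n)
              - β m ω * ∏ i ∈ Finset.range m, (1 - β i ω)‖ₑ)
          atTop (𝓝 0) := by
  have hk0 : 0 < k := by omega
  refine ⟨fun m ω => urnLimit g m ω, fun m => (measurable_urnLimit hgm m).subtype_val,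
    fun m => ?_, ?_, ?_⟩
  · have h := hasLaw_urnLimit hk hgm hg hindep m
    refine ⟨(measurable_urnLimit hgm m).subtype_val.aemeasurable, ?_⟩
    rw [← map_val_betaUnit, ← h.map_eq,
      Measure.map_map measurable_subtype_coe (measurable_urnLimit hgm m)]
    rfl
  · exact (iIndepFun_urnLimit hk hgm hg hindep).comp (fun _ x => (x : ℝ))
      fun _ => measurable_subtype_coe
  · filter_upwards [ae_tendsto_urnLimit hk0 hgm hg hindep,
      ae_frequently_gap_eq_zero hk0 hgm hg hindep,
      ae_tendsto_prod_one_sub_urnLimit hk hgm hg hindep] with ω h1 h2 h3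
    have hW := stirlingGrowth_mem k (fun i => g i ω)
    have hlim := tendsto_blockSize_div hk0 hW (tendsto_card_blocks hk0 h2) h1
    have hp0 : ∀ m, 0 ≤ (urnLimit g m ω : ℝ) *
        ∏ i ∈ Finset.range m, (1 - (urnLimit g i ω : ℝ)) := fun m =>
      mul_nonneg (urnLimit g m ω).2.1
        (Finset.prod_nonneg fun i _ => by linarith [(urnLimit g i ω).2.2])
    refine ⟨tendsto_pi_nhds.2 hlim, tendsto_tsum_enorm_sub_of_hasSum
      (fun n m => by positivity) hp0 ?_ ?_ hlim⟩
    · filter_upwards [eventually_gt_atTop 0] with n hn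
      exact hasSum_blockSize_div (hW n) hk0 hn
    · rw [hasSum_iff_tendsto_nat_of_nonneg hp0]
      simp only [sum_mul_prod_one_sub]
      simpa using h3.const_sub 1

/-- The block sizes of the randomly growing `k`-Stirling permutation. The string `(n+1)^k` is added
at the gap `g n`, which is uniform on the `k * n + 1` gaps, independently for different `n`.
Indices are shifted by one: `β m` here is `β_{m+1}`, with law `Beta((k-1)/k, (m+2)/k)`, and
`blockSize _ m` is the size of the `(m+1)`-st block. Convergence is almost sure, componentwise
(in the product topology) and in the `ℓ¹` metric. -/
theorem mainTheorem4 (k : ℕ) (hk : 2 ≤ k) {Ω : Type*} [MeasurableSpace Ω] (P : Measure Ω)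
    [IsProbabilityMeasure P] (g : (n : ℕ) → Ω → Fin (k * n + 1))
    (hg : ∀ n, HasLaw (g n) (uniformOn (Set.univ : Set (Fin (k * n + 1)))) P)
    (hindep : iIndepFun g P) :
    ∃ β : ℕ → Ω → ℝ,
      (∀ m, Measurable (β m)) ∧
      (∀ m, HasLaw (β m) (betaMeasure (((k : ℝ) - 1) / k) (((m : ℝ) + 2) / k)) P) ∧
      iIndepFun β P ∧
      ∀ᵐ ω ∂P,
        Tendsto
          (fun (n : ℕ) (m : ℕ) =>
            (blockSize (stirlingGrowth k (fun i => g i ω) n) m : ℝ) / ((k : ℝ) * n))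
          atTop (𝓝 (fun m => β m ω * ∏ i ∈ Finset.range m, (1 - β i ω))) ∧
        Tendsto
          (fun n : ℕ => ∑' m : ℕ,
            ‖(blockSize (stirlingGrowth k (fun i => g i ω) n) m : ℝ) / ((k : ℝ) * n)
              - β m ω * ∏ i ∈ Finset.range m, (1 - β i ω)‖ₑ)
          atTop (𝓝 0) := by
  have hae : ∀ᵐ ω ∂P, ∀ n, g n ω = (hg n).aemeasurable.mk (g n) ω :=
    ae_all_iff.2 fun n => (hg n).aemeasurable.ae_eq_mk
  obtain ⟨β, h1, h2, h3, h4⟩ := exists_beta_tendsto_of_measurable k hk P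
    (fun n => (hg n).aemeasurable.mk (g n)) (fun n => (hg n).aemeasurable.measurable_mk)
    (fun n => (hg n).congr (hg n).aemeasurable.ae_eq_mk.symm)
    (hindep.congr fun n => (hg n).aemeasurable.ae_eq_mk)
  refine ⟨β, h1, h2, h3, ?_⟩
  filter_upwards [h4, hae] with ω hω hω'
  simpa only [hω'] using hω
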